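/- Let $n\ge 2$ and let $\mathbb{R}^{n+2}_1$ be the Minkowski spacetime with its inner product $\langle\,,\rangle$ of signature $(-+\cdots+)$ and light-cone $\Lambda^{n+1}=\{x : \langle x,x\rangle=0\}$. Let $(M^n,g)$ be a compact conformally flat Riemannian manifold with (possibly empty) boundary, and let $p:M^n\to\Lambda^{n+1}$ be an isometric immersion, i.e. a smooth map with $\langle dp(v),dp(w)\rangle=g(v,w)$. Let $q:M^n\to\Lambda^{n+1}$ be the dual map of $p$, the unique map with $\langle p,q\rangle=1$ and $\langle dp(v),q\rangle=0$ for all tangent vectors $v$; let $\mathrm{II}(V,W)=(\overline\nabla_V W)^\perp$ be the second fundamental form of $p$ in $\mathbb{R}^{n+2}_1$, and let $A$ be the shape operator, defined by $g(AV,W)=\langle \mathrm{II}(V,W),q\rangle$. Let $\epsilon>0$ and let $F:(-\epsilon,\epsilon)\times M^n\to\mathbb{R}^{n+2}_1$ be a characteristic variation of $p$ with fixed boundary: $F$ is smooth, each $F(t,\cdot)$ is a spacelike immersion (its induced metric $g_t$ is positive definite), $F(0,\cdot)=p$, $F(t,x)=p(x)$ for $x\in\partial M^n$, and there are functions $\phi,\psi:M^n\to\mathbb{R}$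 with $$X:=\frac{\partial F}{\partial t}\Big|_{t=0}=\phi\, q,\qquad \frac{\partial^2 F}{\partial t^2}\Big|_{t=0}=\psi\, q .$$ Let $\mathrm{Vol}(t)$ be the volume of $(M^n,g_t)$ and $dV_0$ the Riemannian volume element of $g=g_0$. If the scalar curvature of $(M^n,g)$ vanishes identically, then $\mathrm{Vol}$ is finite and differentiable on $(-\epsilon,\epsilon)$, its derivative is differentiable at $0$, the function $\langle X,p\rangle^2\,\mathrm{tr}(A^2)$ is integrable, and $$\frac{d^2}{dt^2}\Big|_{t=0}\mathrm{Vol}(t)=-\int_{M^n}\langle X,p\rangle^2\,\mathrm{tr}(A^2)\,dV_0\le 0 .$$ -/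

import Mathlib

open Set Filter Topology MeasureTheory
open scoped Manifold ContDiff

noncomputable section

namespace LightCone

/-! ### The Minkowski spacetime and its light-cone -/

/-- The vector space underlying the `(n+2)`-dimensional Minkowski spacetime (only its linear
structure and its topology are used; the geometry is carried by `minkowski`). -/
abbrev Minkowski (n : ℕ) : Type := EuclideanSpace ℝ (Fin (n + 2))

/-- The Lorentzian inner product of signature `(-+⋯+)`. -/
def minkowski {n : ℕ} (x y : Minkowski n) : ℝ :=
  -(x 0 * y 0) + ∑ i : Fin (n + 1), x i.succ * y i.succ

/-- The light-cone `Λ^{n+1}`. -/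
def lightCone (n : ℕ) : Set (Minkowski n) := {x | minkowski x x = 0}

section Manifold

variable {n : ℕ} [NeZero n]
  {M : Type*} [TopologicalSpace M] [ChartedSpace (EuclideanHalfSpace n) M]

variable (n M) in
/-- A field of (not necessarily linear or symmetric) real functions of two tangent vectors; used for
the metrics on `M`. -/
abbrev TangentForm : Type _ :=
  ∀ x : M, TangentSpace (𝓡∂ n) x → TangentSpace (𝓡∂ n) x → ℝ

/-- The form on `M` given by a smooth Riemannian metric. -/
def metricForm [IsManifold (𝓡∂ n) ∞ M]
    (g : Bundle.ContMDiffRiemannianMetric (𝓡∂ n) ∞ (EuclideanSpace ℝ (Fin n))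
      (fun x : M ↦ TangentSpace (𝓡∂ n) x)) : TangentForm n M := fun x v w ↦ g.inner x v w

/-- The form on `M` induced by a map into the Minkowski spacetime. -/
def inducedForm (f : M → Minkowski n) : TangentForm n M := fun x v w ↦
  minkowski (n := n) (mfderiv (𝓡∂ n) 𝓘(ℝ, Minkowski n) f x v)
    (mfderiv (𝓡∂ n) 𝓘(ℝ, Minkowski n) f x w)

/-- The `k`-th vector of the standard basis of the model space `ℝⁿ`. -/
def stdVec (k : Fin n) : EuclideanSpace ℝ (Fin n) := EuclideanSpace.single k 1

/-- The `k`-th coordinate vector field `∂ₖ` of the chart centred at `c`, at the point with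
coordinates `y`. -/
def coordVec (c : M) (y : EuclideanSpace ℝ (Fin n)) (k : Fin n) :
    TangentSpace (𝓡∂ n) ((extChartAt (𝓡∂ n) c).symm y) :=
  mfderivWithin 𝓘(ℝ, EuclideanSpace ℝ (Fin n)) (𝓡∂ n) (extChartAt (𝓡∂ n) c).symm
    (range (𝓡∂ n)) y (stdVec k)

/-- The matrix `(h(∂ᵢ, ∂ⱼ))` of a form in the chart centred at `c`, as a function of the
coordinates. -/
def coordMatrix (h : TangentForm n M) (c : M) (y : EuclideanSpace ℝ (Fin n)) :
    Matrix (Fin n) (Fin n) ℝ :=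
  Matrix.of fun i j ↦ h ((extChartAt (𝓡∂ n) c).symm y) (coordVec c y i) (coordVec c y j)

/-! ### The Riemannian volume -/

/-- The volume of a metric `h` in the chart centred at `c`, that is
`√(det h_{ij}) dy¹ ⋯ dyⁿ` on the domain of this chart. -/
def chartVolume [MeasurableSpace M] (h : TangentForm n M) (c : M) : Measure M :=
  (((volume : Measure (EuclideanSpace ℝ (Fin n))).restrict
      (extChartAt (𝓡∂ n) c).target).withDensity
    fun y ↦ ENNReal.ofReal (Real.sqrt (coordMatrix h c y).det)).map (extChartAt (𝓡∂ n) c).symm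

variable (n M) in
/-- A smooth partition of unity subordinate to the domains of the charts. -/
def chartPartition [CompactSpace M] [T2Space M] [IsManifold (𝓡∂ n) ∞ M] :
    SmoothPartitionOfUnity M (𝓡∂ n) M univ :=
  Classical.choose (SmoothPartitionOfUnity.exists_isSubordinate_chartAt_source (𝓡∂ n) M)

/-- The Riemannian volume measure `dV` of a metric `h` on `M`, glued from its expressions in the
charts, `∫ f dV = ∑_c ∫ ρ_c f √(det h_{ij}) dy¹ ⋯ dyⁿ`. By the change of variables formula it does
not depend on the partition of unity `ρ`. -/
def volumeMeasure [CompactSpace M] [T2Space M] [IsManifold (𝓡∂ n) ∞ M] [MeasurableSpace M]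
    (h : TangentForm n M) : Measure M :=
  Measure.sum fun c : M ↦
    (chartVolume h c).withDensity fun x ↦ ENNReal.ofReal (chartPartition n M c x)

/-! ### Scalar curvature and conformal flatness -/

/-- The partial derivative `∂ₖ u` of a function of the coordinates (one-sided at the boundary of
the half-space). -/
def coordDeriv (k : Fin n) (u : EuclideanSpace ℝ (Fin n) → ℝ) (y : EuclideanSpace ℝ (Fin n)) : ℝ :=
  fderivWithin ℝ u (range (𝓡∂ n)) y (stdVec k)

/-- The Christoffel symbols `Γ^k_{ij}` of the Levi-Civita connection of a metric `h` in the chart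
centred at `c`. -/
def christoffel (h : TangentForm n M) (c : M) (k i j : Fin n)
    (y : EuclideanSpace ℝ (Fin n)) : ℝ :=
  (1 / 2) * ∑ l, (coordMatrix h c y)⁻¹ k l *
    (coordDeriv i (fun z ↦ coordMatrix h c z j l) y
      + coordDeriv j (fun z ↦ coordMatrix h c z i l) y
      - coordDeriv l (fun z ↦ coordMatrix h c z i j) y)

/-- The component along `∂ₗ` of `R(∂ᵢ, ∂ⱼ)∂ₖ`, where
`R(X,Y)Z = ∇_X ∇_Y Z - ∇_Y ∇_X Z - ∇_{[X,Y]} Z`. -/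
def curvatureTensor (h : TangentForm n M) (c : M) (l k i j : Fin n)
    (y : EuclideanSpace ℝ (Fin n)) : ℝ :=
  coordDeriv i (christoffel h c l j k) y - coordDeriv j (christoffel h c l i k) y
    + ∑ m, (christoffel h c m j k y * christoffel h c l i m y
      - christoffel h c m i k y * christoffel h c l j m y)

/-- The scalar curvature `S` of a metric `h` at `x`: the trace with respect to `h` of the Ricci
tensor `Ric(Y,Z) = tr (X ↦ R(X,Y)Z)`, computed in the chart centred at `x`. -/
def scalarCurvature (h : TangentForm n M) (x : M) : ℝ :=
  ∑ j, ∑ k, (coordMatrix h x (extChartAt (𝓡∂ n) x x))⁻¹ j k *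
    ∑ i, curvatureTensor h x i k i j (extChartAt (𝓡∂ n) x x)

/-- Local conformal flatness: near each point, the metric is the pull-back of the Euclidean metric
by some smooth map to `ℝⁿ`, up to a positive smooth factor. -/
def IsConformallyFlat (h : TangentForm n M) : Prop :=
  ∀ x : M, ∃ U : Set M, IsOpen U ∧ x ∈ U ∧
    ∃ (f : M → EuclideanSpace ℝ (Fin n)) (lam : M → ℝ),
      ContMDiffOn (𝓡∂ n) 𝓘(ℝ, EuclideanSpace ℝ (Fin n)) ∞ f U ∧
      ContMDiffOn (𝓡∂ n) 𝓘(ℝ, ℝ) ∞ lam U ∧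
      ∀ y ∈ U, 0 < lam y ∧ ∀ v w : TangentSpace (𝓡∂ n) y,
        h y v w = lam y * inner ℝ (E := EuclideanSpace ℝ (Fin n))
          (mfderiv (𝓡∂ n) 𝓘(ℝ, EuclideanSpace ℝ (Fin n)) f y v)
          (mfderiv (𝓡∂ n) 𝓘(ℝ, EuclideanSpace ℝ (Fin n)) f y w)

/-! ### Hypersurfaces in the light-cone -/

/-- `p` is a (smooth) isometric immersion of `(M, h)` into the light-cone. -/
structure IsIsometricImmersion (h : TangentForm n M) (p : M → Minkowski n) : Prop where
  smooth : ContMDiff (𝓡∂ n) 𝓘(ℝ, Minkowski n) ∞ p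
  mem_lightCone : ∀ x, p x ∈ lightCone n
  isometric : ∀ (x : M) (v w : TangentSpace (𝓡∂ n) x), inducedForm p x v w = h x v w

/-- The dual map `q` of `p`: the unique map with values in the light-cone such that `⟨p, q⟩ = 1`
and `q` is orthogonal to all tangent vectors of `p`. -/
def dualMap (p : M → Minkowski n) (x : M) : Minkowski n :=
  Classical.epsilon fun q : Minkowski n ↦ q ∈ lightCone n ∧ minkowski (p x) q = 1 ∧
    ∀ v : TangentSpace (𝓡∂ n) x,
      minkowski (n := n) (mfderiv (𝓡∂ n) 𝓘(ℝ, Minkowski n) p x v) q = 0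

/-- The orthogonal projection of an ambient vector to the normal space at `x`, which is spanned by
the null frame `p x`, `q x` with `⟨p x, q x⟩ = 1`. -/
def normalProj (p : M → Minkowski n) (x : M) (u : Minkowski n) : Minkowski n :=
  minkowski u (dualMap p x) • p x + minkowski u (p x) • dualMap p x

/-- The second fundamental form `II(v, w) = (∇̄_v W)^⊥`, where `W` is the extension of `w` to a
tangent vector field with constant coordinates in the chart centred at `x`. (A tangent vector at
`x` is represented by its coordinates in this chart.) -/
def secondFundamentalForm (p : M → Minkowski n) (x : M) (v w : TangentSpace (𝓡∂ n) x) :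
    Minkowski n :=
  normalProj p x
    (fderivWithin ℝ
      (fun y ↦ fderivWithin ℝ (p ∘ (extChartAt (𝓡∂ n) x).symm) (range (𝓡∂ n)) y)
      (range (𝓡∂ n)) (extChartAt (𝓡∂ n) x x)
      (v : EuclideanSpace ℝ (Fin n)) (w : EuclideanSpace ℝ (Fin n)))

/-- The shape operator `A` at `x`: the unique endomorphism of the tangent space such that
`⟨A v, w⟩ = ⟨II(v, w), q⟩`. -/
def shapeOperator (p : M → Minkowski n) (x : M) :
    TangentSpace (𝓡∂ n) x →ₗ[ℝ] TangentSpace (𝓡∂ n) x :=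
  Classical.epsilon fun A : TangentSpace (𝓡∂ n) x →ₗ[ℝ] TangentSpace (𝓡∂ n) x ↦
    ∀ v w : TangentSpace (𝓡∂ n) x,
      inducedForm p x (A v) w = minkowski (secondFundamentalForm p x v w) (dualMap p x)

/-! ### Variations -/

/-- `F : (-ε, ε) × M → ℝ^{n+2}_1` is a variation of `p` with fixed boundary. (Only the values
`F t x` with `|t| < ε` matter.) -/
structure IsVariation (p : M → Minkowski n) (ε : ℝ) (F : ℝ → M → Minkowski n) : Prop where
  smooth : ContMDiffOn (𝓘(ℝ, ℝ).prod (𝓡∂ n)) 𝓘(ℝ, Minkowski n) ∞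
    (fun z : ℝ × M ↦ F z.1 z.2) (Ioo (-ε) ε ×ˢ univ)
  spacelike : ∀ t ∈ Ioo (-ε) ε, ∀ (x : M) (v : TangentSpace (𝓡∂ n) x), v ≠ 0 →
    0 < inducedForm (F t) x v v
  initial : ∀ x, F 0 x = p x
  boundary : ∀ t ∈ Ioo (-ε) ε, ∀ x ∈ (𝓡∂ n).boundary M, F t x = p x

/-- The extended variational vector field `X̄ = ∂F/∂t`. -/
def extVariationField (F : ℝ → M → Minkowski n) (t : ℝ) (x : M) : Minkowski n :=
  deriv (fun s ↦ F s x) t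

/-- The variational vector field `X`. -/
def variationField (F : ℝ → M → Minkowski n) (x : M) : Minkowski n := extVariationField F 0 x

/-- The vector field `∇̄ₜ X̄` along `p`, that is `∂²F/∂t²` at `t = 0`. -/
def accelerationField (F : ℝ → M → Minkowski n) (x : M) : Minkowski n :=
  deriv (fun t ↦ extVariationField F t x) 0

/-- An admissible variation: the variational vector field is a multiple of the dual map. -/
structure IsAdmissibleVariation (p : M → Minkowski n) (ε : ℝ) (F : ℝ → M → Minkowski n) : Prop
    extends IsVariation p ε F where
  admissible : ∃ φ : M → ℝ, ∀ x, variationField F x = φ x • dualMap p x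

/-- A characteristic variation: an admissible one such that `∇̄ₜ X̄` is a multiple of the dual
map. -/
structure IsCharacteristicVariation (p : M → Minkowski n) (ε : ℝ) (F : ℝ → M → Minkowski n) : Prop
    extends IsAdmissibleVariation p ε F where
  characteristic : ∃ φ : M → ℝ, ∀ x, accelerationField F x = φ x • dualMap p x

/-- The volume `Vol(t)` of `M` with the metric induced by `F(t, ·)`. -/
def variationVolume [CompactSpace M] [T2Space M] [IsManifold (𝓡∂ n) ∞ M] [MeasurableSpace M]
    (F : ℝ → M → Minkowski n) (t : ℝ) : ℝ :=
  (volumeMeasure (inducedForm (F t))).real univ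

/-- The function `⟨X, p⟩² tr(A²)` on `M`. -/
def secondVariationDensity (p : M → Minkowski n) (F : ℝ → M → Minkowski n) (x : M) : ℝ :=
  minkowski (variationField F x) (p x) ^ 2 *
    LinearMap.trace ℝ (TangentSpace (𝓡∂ n) x) (shapeOperator p x ∘ₗ shapeOperator p x)

end Manifold

end LightCone

end

/-!
Let `q` be the dual map of `p` and `A` the shape operator, so that `⟨∂ᵢ∂ⱼp, q⟩` is the matrix of
`g(A ·, ·)` in a chart.

*The trace of `A` vanishes.* Since `⟨∂ᵢ∂ⱼp, p⟩ = -⟨∂ᵢp, ∂ⱼp⟩`, the second fundamental form is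
`g(A ·, ·) p - g q`, and the Gauss equation (`gauss_equation`) expresses the curvature of `g`
linearly in `A`. Its full contraction is `S = -2(n-1) tr A` (`scalar_curvature_eq`), hence
`S = 0` forces `tr A = 0` (`IsSpacelikeImmersion.trace_shapeOperator_eq_zero`). The equation is obtained by
differentiating `∑ Γᵐⱼₖ gₘₗ = ⟨∂ⱼ∂ₖp, ∂ₗp⟩`, which avoids differentiating `q`.

*The second variation of the volume density.* Let `G(t)` be the matrix of `g_t` in a chart. As
`X = φ q` and `∂ₜ²F = ψ q`, one finds `G' = -2φ a` and `G'' = -2ψ a + 2φ² a G⁻¹ a` at `t = 0`, where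
`a` is the matrix of `g(A ·, ·)` (`minkowski_pd_normal_tangent`, `minkowski_pd_normal`). Jacobi's
formula, used twice, together with `tr A = 0` gives
`∂ₜ² √(det G) = -φ² tr(A²) √(det G)` at `t = 0` (`hasDerivAt_deriv_density`), and `φ = ⟨X, p⟩`. The
terms in `ψ` come with the factor `tr A`, so that they vanish pointwise.

*Integration.* The partition of unity reduces the volume to finitely many integrals over compact
subsets of chart domains, with smooth densities, which may be differentiated under the integral sign
(`hasDerivAt_integral_slice`). The traces of `A` and `A²` do not depend on the chart, because the
normal part of the second derivative is tensorial (`minkowski_pd_pd_comp`). Finally `tr(A²) ≥ 0`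
because `A` is symmetric with respect to `g`.
-/

namespace LightCone

/-! ### Linear algebra of the Minkowski spacetime -/

section Algebra

variable {n : ℕ}

variable (n) in
/-- The Lorentzian inner product as a continuous bilinear map. -/
noncomputable def minkowskiBilin : Minkowski n →L[ℝ] Minkowski n →L[ℝ] ℝ :=
  (LinearMap.mk₂ ℝ (minkowski (n := n))
    (fun x y z ↦ by simp [minkowski, add_mul, Finset.sum_add_distrib]; ring)
    (fun c x y ↦ by simp [minkowski, mul_add, Finset.mul_sum, mul_assoc])
    (fun x y z ↦ by simp [minkowski, mul_add, Finset.sum_add_distrib]; ring)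
    (fun c x y ↦ by
      simp [minkowski, mul_add, Finset.mul_sum, mul_left_comm])).toContinuousBilinearMap

lemma minkowskiBilin_apply (x y : Minkowski n) : minkowskiBilin n x y = minkowski x y := rfl

lemma minkowski_comm (x y : Minkowski n) : minkowski x y = minkowski y x := by
  simp [minkowski, mul_comm]

lemma minkowski_add_left (x y z : Minkowski n) :
    minkowski (x + y) z = minkowski x z + minkowski y z := by
  simp [← minkowskiBilin_apply]

lemma minkowski_add_right (x y z : Minkowski n) :
    minkowski x (y + z) = minkowski x y + minkowski x z := by
  simp [← minkowskiBilin_apply]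

lemma minkowski_sub_left (x y z : Minkowski n) :
    minkowski (x - y) z = minkowski x z - minkowski y z := by
  simp [← minkowskiBilin_apply]

lemma minkowski_sub_right (x y z : Minkowski n) :
    minkowski x (y - z) = minkowski x y - minkowski x z := by
  simp [← minkowskiBilin_apply]

lemma minkowski_smul_left (c : ℝ) (x y : Minkowski n) :
    minkowski (c • x) y = c * minkowski x y := by
  simp [← minkowskiBilin_apply]

lemma minkowski_smul_right (c : ℝ) (x y : Minkowski n) :
    minkowski x (c • y) = c * minkowski x y := by
  simp [← minkowskiBilin_apply]

lemma minkowski_sum_left {ι : Type*} (s : Finset ι) (x : ι → Minkowski n) (y : Minkowski n) :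
    minkowski (∑ i ∈ s, x i) y = ∑ i ∈ s, minkowski (x i) y := by
  simp [← minkowskiBilin_apply]

lemma minkowski_sum_right {ι : Type*} (s : Finset ι) (x : Minkowski n) (y : ι → Minkowski n) :
    minkowski x (∑ i ∈ s, y i) = ∑ i ∈ s, minkowski x (y i) := by
  simp [← minkowskiBilin_apply]

@[simp] lemma minkowski_zero_left (x : Minkowski n) : minkowski 0 x = 0 := by
  simp [← minkowskiBilin_apply]

@[simp] lemma minkowski_zero_right (x : Minkowski n) : minkowski x 0 = 0 := by
  simp [← minkowskiBilin_apply]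

/-- A nonzero null vector has a nonzero time component. -/
lemma time_ne_zero {x : Minkowski n} (h : minkowski x x = 0) (hx : x ≠ 0) : x 0 ≠ 0 := by
  intro h0
  apply hx
  have h1 : ∑ i : Fin (n + 1), x i.succ * x i.succ = 0 := by simpa [minkowski, h0] using h
  rw [Finset.sum_eq_zero_iff_of_nonneg (fun i _ ↦ mul_self_nonneg _)] at h1
  ext i
  refine Fin.cases h0 (fun j ↦ ?_) i
  simpa using h1 j (Finset.mem_univ j)

variable {E : Type*} [AddCommGroup E] [Module ℝ E] [FiniteDimensional ℝ E]

/-- The pull-back of the Lorentzian inner product by a linear map. -/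
noncomputable def pullbackForm (L : E →ₗ[ℝ] Minkowski n) : E →ₗ[ℝ] Module.Dual ℝ E :=
  LinearMap.mk₂ ℝ (fun v w ↦ minkowski (L v) (L w))
    (by simp [minkowski_add_left]) (by simp [minkowski_smul_left])
    (by simp [minkowski_add_right]) (by simp [minkowski_smul_right])

/-- The Lorentzian inner product is nondegenerate on a spacelike subspace. -/
lemma bijective_pullbackForm (L : E →ₗ[ℝ] Minkowski n)
    (hpos : ∀ v, v ≠ 0 → 0 < minkowski (L v) (L v)) : Function.Bijective (pullbackForm L) := by
  have hinj : Function.Injective (pullbackForm L) := by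
    rw [← LinearMap.ker_eq_bot, LinearMap.ker_eq_bot']
    intro v hv
    by_contra hne
    have h2 : pullbackForm L v v = 0 := by rw [hv]; rfl
    exact absurd h2 (hpos v hne).ne'
  exact ⟨hinj, (LinearMap.injective_iff_surjective_of_finrank_eq_finrank
    (Subspace.dual_finrank_eq (K := ℝ) (V := E)).symm).1 hinj⟩

/-- A bilinear form on a spacelike subspace is represented by an endomorphism. -/
lemma exists_endomorphism (L : E →ₗ[ℝ] Minkowski n)
    (hpos : ∀ v, v ≠ 0 → 0 < minkowski (L v) (L v)) (a : E →ₗ[ℝ] E →ₗ[ℝ] ℝ) :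
    ∃ A : E →ₗ[ℝ] E, ∀ v w, minkowski (L (A v)) (L w) = a v w := by
  let e := LinearEquiv.ofBijective _ (bijective_pullbackForm L hpos)
  refine ⟨e.symm.toLinearMap ∘ₗ a, fun v w ↦ ?_⟩
  have : e (e.symm (a v)) = a v := e.apply_symm_apply _
  exact congrArg (fun l ↦ l w) this

/-- The spacelike subspace that is the image of `L`, with a pair of null normal vectors
`p`, `q` such that `⟨p, q⟩ = 1`. -/
structure IsNullFrame (L : E →ₗ[ℝ] Minkowski n) (p q : Minkowski n) : Prop where
  pos : ∀ v, v ≠ 0 → 0 < minkowski (L v) (L v)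
  pp : minkowski p p = 0
  qq : minkowski q q = 0
  pq : minkowski p q = 1
  Lp : ∀ v, minkowski (L v) p = 0
  Lq : ∀ v, minkowski (L v) q = 0

/-- The dual null normal vector exists: subtract from the time direction its tangential part, then
correct by a multiple of `p`. -/
lemma exists_isNullFrame (L : E →ₗ[ℝ] Minkowski n)
    (hpos : ∀ v, v ≠ 0 → 0 < minkowski (L v) (L v)) {p : Minkowski n} (hp : minkowski p p = 0)
    (hp0 : p ≠ 0) (hLp : ∀ v, minkowski (L v) p = 0) : ∃ q, IsNullFrame L p q := by
  let e : Minkowski n := EuclideanSpace.single 0 1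
  obtain ⟨v, hv⟩ := (bijective_pullbackForm L hpos).2 ((minkowskiBilin n e).toLinearMap ∘ₗ L)
  have hv' : ∀ w, minkowski (L v) (L w) = minkowski e (L w) := fun w ↦ congrArg (fun l ↦ l w) hv
  set w := e - L v with hw
  have hLw : ∀ u, minkowski (L u) w = 0 := fun u ↦ by
    rw [hw, minkowski_sub_right, minkowski_comm _ (L v), hv', minkowski_comm e, sub_self]
  have hpw : minkowski p w ≠ 0 := by
    have : minkowski p w = - p 0 := by
      rw [hw, minkowski_sub_right, minkowski_comm p (L v), hLp, sub_zero]
      simp [minkowski, e]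
    rw [this]
    exact neg_ne_zero.2 (time_ne_zero hp hp0)
  refine ⟨(minkowski p w)⁻¹ • w - (minkowski w w / (2 * minkowski p w ^ 2)) • p,
    hpos, hp, ?_, ?_, hLp, ?_⟩
  · simp only [minkowski_sub_left, minkowski_sub_right, minkowski_smul_left,
      minkowski_smul_right, hp, minkowski_comm w p]
    field_simp
    ring
  · simp only [minkowski_sub_right, minkowski_smul_right, hp]
    field_simp
    ring
  · intro u
    simp only [minkowski_sub_right, minkowski_smul_right, hLp, hLw]
    ring

/-- A vector orthogonal to the spacelike subspace of a null frame of maximal rank is a combination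
of the two null normals. -/
lemma IsNullFrame.eq_add {L : E →ₗ[ℝ] Minkowski n} {p q : Minkowski n} (h : IsNullFrame L p q)
    (hE : Module.finrank ℝ E = n) {z : Minkowski n} (hz : ∀ v, minkowski z (L v) = 0) :
    z = minkowski z q • p + minkowski z p • q := by
  let Φ : (ℝ × ℝ) × E →ₗ[ℝ] Minkowski n :=
    ((LinearMap.toSpanSingleton ℝ _ p).coprod (LinearMap.toSpanSingleton ℝ _ q)).coprod L
  have hΦ : ∀ a b v, Φ ((a, b), v) = a • p + b • q + L v := fun a b v ↦ by simp [Φ]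
  have hqp : minkowski q p = 1 := by rw [minkowski_comm, h.pq]
  have hinj : Function.Injective Φ := by
    rw [← LinearMap.ker_eq_bot, LinearMap.ker_eq_bot']
    rintro ⟨⟨a, b⟩, v⟩ h0
    rw [hΦ] at h0
    have ha : a = 0 := by
      have := congrArg (fun x ↦ minkowski x q) h0
      simpa [minkowski_add_left, minkowski_smul_left, h.pq, h.qq, h.Lq] using this
    have hb : b = 0 := by
      have := congrArg (fun x ↦ minkowski x p) h0
      simpa [minkowski_add_left, minkowski_smul_left, hqp, h.pp, h.Lp] using this
    subst ha hb
    have hv : v = 0 := by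
      by_contra hne
      have := h.pos v hne
      simp only [zero_smul, zero_add] at h0
      simp [h0] at this
    simp [hv]
  have hsurj := (LinearMap.injective_iff_surjective_of_finrank_eq_finrank
    (by simp [hE]; omega)).1 hinj
  obtain ⟨⟨⟨a, b⟩, v⟩, rfl⟩ := hsurj z
  rw [hΦ] at hz ⊢
  have hpL : ∀ u, minkowski p (L u) = 0 := fun u ↦ by rw [minkowski_comm, h.Lp]
  have hqL : ∀ u, minkowski q (L u) = 0 := fun u ↦ by rw [minkowski_comm, h.Lq]
  have hv : v = 0 := by
    by_contra hne
    have h1 := hz v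
    simp only [minkowski_add_left, minkowski_smul_left, hpL, hqL] at h1
    have := h.pos v hne
    linarith
  subst hv
  simp [minkowski_add_left, minkowski_smul_left, h.pp, h.qq, h.pq, hqp]

end Algebra

/-! ### Directional derivatives on a domain with boundary -/

section Calculus

variable {W : Type*} [NormedAddCommGroup W] [NormedSpace ℝ W]
  {X : Type*} [NormedAddCommGroup X] [NormedSpace ℝ X]

/-- The derivative of `u` in the direction `v`, within the domain `S`. -/
noncomputable def pd (S : Set W) (v : W) (u : W → X) (z : W) : X := fderivWithin ℝ u S z v

/-- Domains, such as open subsets of half-spaces, on which derivatives within the domain are unique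
and second derivatives are symmetric. -/
structure IsRegularDomain (S : Set W) : Prop where
  uniqueDiffOn : UniqueDiffOn ℝ S
  subset_closure : S ⊆ closure (interior S)

variable {S : Set W} {u : W → X} {v w z : W}

lemma pd_congr {u' : W → X} (h : ∀ z ∈ S, u z = u' z) (hz : z ∈ S) :
    pd S v u z = pd S v u' z := by
  rw [pd, pd, fderivWithin_congr h (h z hz)]

lemma contDiffOn_pd (hS : IsRegularDomain S) (hu : ContDiffOn ℝ ∞ u S) (v : W) :
    ContDiffOn ℝ ∞ (pd S v u) S :=
  (hu.fderivWithin hS.uniqueDiffOn (by simp)).clm_apply contDiffOn_const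

lemma pd_pd (hS : IsRegularDomain S) (hu : ContDiffOn ℝ ∞ u S) (hz : z ∈ S) :
    pd S v (pd S w u) z = fderivWithin ℝ (fun y ↦ fderivWithin ℝ u S y) S z v w := by
  have h : DifferentiableWithinAt ℝ (fun y ↦ fderivWithin ℝ u S y) S z :=
    ((hu.fderivWithin hS.uniqueDiffOn (m := ∞) (by simp)) z hz).differentiableWithinAt (by simp)
  have h2 := (h.hasFDerivWithinAt.clm_apply (hasFDerivWithinAt_const w z S)).fderivWithin
    (hS.uniqueDiffOn z hz)
  have h3 : pd S w u = fun y ↦ fderivWithin ℝ u S y w := rfl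
  rw [h3, pd, h2]
  simp

lemma pd_comm (hS : IsRegularDomain S) (hu : ContDiffOn ℝ ∞ u S) (hz : z ∈ S) :
    pd S v (pd S w u) z = pd S w (pd S v u) z := by
  rw [pd_pd hS hu hz, pd_pd hS hu hz]
  have h2 : minSmoothness ℝ 2 ≤ ∞ := by
    simp only [minSmoothness_of_isRCLikeNormedField]
    exact WithTop.coe_le_coe.2 (le_top : (2 : ℕ∞) ≤ ⊤)
  exact ((hu z hz).isSymmSndFDerivWithinAt h2 hS.uniqueDiffOn (hS.subset_closure hz) hz).eq
    v w

lemma pd_const (c : X) : pd S v (fun _ ↦ c) z = 0 := by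
  simp [pd]

lemma pd_mul (hS : IsRegularDomain S) {u₁ u₂ : W → ℝ} (h₁ : ContDiffOn ℝ ∞ u₁ S)
    (h₂ : ContDiffOn ℝ ∞ u₂ S) (hz : z ∈ S) :
    pd S v (fun y ↦ u₁ y * u₂ y) z = pd S v u₁ z * u₂ z + u₁ z * pd S v u₂ z := by
  have d₁ := (h₁ z hz).differentiableWithinAt (by simp)
  have d₂ := (h₂ z hz).differentiableWithinAt (by simp)
  rw [pd, fderivWithin_fun_mul (hS.uniqueDiffOn z hz) d₁ d₂]
  simp [pd]
  ring

lemma pd_sum (hS : IsRegularDomain S) {ι : Type*} (s : Finset ι) {u : ι → W → X}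
    (h : ∀ i, ContDiffOn ℝ ∞ (u i) S) (hz : z ∈ S) :
    pd S v (fun y ↦ ∑ i ∈ s, u i y) z = ∑ i ∈ s, pd S v (u i) z := by
  rw [pd, fderivWithin_fun_sum (hS.uniqueDiffOn z hz)
    (fun i _ ↦ (h i z hz).differentiableWithinAt (by simp))]
  simp [pd]

variable {n : ℕ} {f₁ f₂ : W → Minkowski n}

lemma contDiffOn_minkowski (h₁ : ContDiffOn ℝ ∞ f₁ S) (h₂ : ContDiffOn ℝ ∞ f₂ S) :
    ContDiffOn ℝ ∞ (fun y ↦ minkowski (f₁ y) (f₂ y)) S :=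
  ((minkowskiBilin n).contDiff.comp_contDiffOn h₁).clm_apply h₂

lemma pd_minkowski (hS : IsRegularDomain S) (h₁ : ContDiffOn ℝ ∞ f₁ S)
    (h₂ : ContDiffOn ℝ ∞ f₂ S) (hz : z ∈ S) :
    pd S v (fun y ↦ minkowski (f₁ y) (f₂ y)) z =
      minkowski (pd S v f₁ z) (f₂ z) + minkowski (f₁ z) (pd S v f₂ z) := by
  have d₁ := ((h₁ z hz).differentiableWithinAt (by simp)).hasFDerivWithinAt
  have d₂ := ((h₂ z hz).differentiableWithinAt (by simp)).hasFDerivWithinAt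
  have h := ((minkowskiBilin n).hasFDerivWithinAt_of_bilinear d₁ d₂).fderivWithin
    (hS.uniqueDiffOn z hz)
  change fderivWithin ℝ (fun y ↦ minkowskiBilin n (f₁ y) (f₂ y)) S z v = _
  rw [h]
  simp [pd, minkowskiBilin_apply]
  ring

/-! ### One-parameter families -/

/-- On a product `I × T` the derivative along `T` may be taken on the slice. -/
lemma pd_slice {I : Set ℝ} {T : Set W} {u : ℝ × W → X} (hT : UniqueDiffOn ℝ T)
    (hu : ContDiffOn ℝ ∞ u (I ×ˢ T)) {t : ℝ} (ht : t ∈ I) {y : W} (hy : y ∈ T) (v : W) :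
    pd T v (fun y ↦ u (t, y)) y = pd (I ×ˢ T) ((0 : ℝ), v) u (t, y) := by
  have d := ((hu (t, y) ⟨ht, hy⟩).differentiableWithinAt (by simp)).hasFDerivWithinAt
  have h1 : HasFDerivWithinAt (fun y : W ↦ (t, y)) (ContinuousLinearMap.inr ℝ ℝ W) T y :=
    (hasFDerivWithinAt_const t y T).prodMk (hasFDerivWithinAt_id y T)
  have h2 := (d.comp y h1 (fun z hz ↦ ⟨ht, hz⟩)).fderivWithin (hT y hy)
  change fderivWithin ℝ (u ∘ fun y : W ↦ (t, y)) T y v = _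
  rw [h2]
  simp [pd]

/-- On a product `I × T` with `I` open, the derivative along `I` is the ordinary one. -/
lemma hasDerivAt_slice {I : Set ℝ} (hI : IsOpen I) {T : Set W} {u : ℝ × W → X}
    (hu : ContDiffOn ℝ ∞ u (I ×ˢ T)) {t : ℝ} (ht : t ∈ I) {y : W} (hy : y ∈ T) :
    HasDerivAt (fun s ↦ u (s, y)) (pd (I ×ˢ T) ((1 : ℝ), (0 : W)) u (t, y)) t := by
  have d := ((hu (t, y) ⟨ht, hy⟩).differentiableWithinAt (by simp)).hasFDerivWithinAt
  have h1 : HasDerivWithinAt (fun s : ℝ ↦ (s, y)) ((1 : ℝ), (0 : W)) I t :=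
    (hasDerivWithinAt_id t I).prodMk (hasDerivWithinAt_const t I y)
  have hm : MapsTo (fun s : ℝ ↦ (s, y)) I (I ×ˢ T) := fun s hs ↦ ⟨hs, hy⟩
  exact (d.comp_hasDerivWithinAt t h1 hm).hasDerivAt (hI.mem_nhds ht)

lemma IsRegularDomain.prod {I : Set ℝ} (hI : IsOpen I) {T : Set W} (hT : IsRegularDomain T) :
    IsRegularDomain (I ×ˢ T) where
  uniqueDiffOn := hI.uniqueDiffOn.prod hT.uniqueDiffOn
  subset_closure := by
    rw [interior_prod_eq, hI.interior_eq, closure_prod_eq]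
    exact Set.prod_mono _root_.subset_closure hT.subset_closure

end Calculus

/-! ### The second derivative of the square root of a determinant -/

section Determinant

variable {ι : Type*} [Fintype ι] [DecidableEq ι]

/-- Jacobi's formula. -/
lemma hasDerivAt_det {G : ℝ → Matrix ι ι ℝ} {G' : Matrix ι ι ℝ} {t : ℝ}
    (h : ∀ i j, HasDerivAt (fun s ↦ G s i j) (G' i j) t) :
    HasDerivAt (fun s ↦ (G s).det) ((G t).adjugate * G').trace t := by
  have h1 : HasDerivAt (fun s ↦ (G s).det) (∑ σ : Equiv.Perm ι, (Equiv.Perm.sign σ : ℝ) *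
      ∑ i, (∏ j ∈ Finset.univ.erase i, G t (σ j) j) • G' (σ i) i) t := by
    simp only [Matrix.det_apply']
    exact HasDerivAt.fun_sum fun σ _ ↦
      (HasDerivAt.fun_finsetProd (fun i _ ↦ h (σ i) i)).const_mul _
  convert h1 using 1
  have h2 : ∀ i, ((G t).adjugate * G') i i = ((G t).updateCol i (fun k ↦ G' k i)).det := by
    intro i
    rw [← Matrix.cramer_apply, Matrix.cramer_eq_adjugate_mulVec]
    rfl
  simp only [Matrix.trace, Matrix.diag, h2, Matrix.det_apply', Finset.mul_sum]
  rw [Finset.sum_comm]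
  refine Finset.sum_congr rfl fun σ _ ↦ Finset.sum_congr rfl fun i _ ↦ ?_
  rw [← Finset.mul_prod_erase _ _ (Finset.mem_univ i), Matrix.updateCol_self, smul_eq_mul,
    mul_comm (G' _ _)]
  congr 2
  exact Finset.prod_congr rfl fun j hj ↦ by rw [Matrix.updateCol_ne (Finset.ne_of_mem_erase hj)]

lemma exists_hasDerivAt_adjugate {G : ℝ → Matrix ι ι ℝ} {G' : Matrix ι ι ℝ} {t : ℝ}
    (h : ∀ i j, HasDerivAt (fun s ↦ G s i j) (G' i j) t) :
    ∃ R : Matrix ι ι ℝ, ∀ i j, HasDerivAt (fun s ↦ (G s).adjugate i j) (R i j) t := by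
  have h1 : ∀ i j, DifferentiableAt ℝ (fun s ↦ (G s).adjugate i j) t := by
    intro i j
    simp only [Matrix.adjugate_apply]
    refine (hasDerivAt_det (G' := G'.updateRow j 0) fun k l ↦ ?_).differentiableAt
    by_cases hk : k = j
    · subst hk
      simpa using hasDerivAt_const t _
    · simpa [Matrix.updateRow_ne hk] using h k l
  exact ⟨Matrix.of fun i j ↦ deriv (fun s ↦ (G s).adjugate i j) t, fun i j ↦ (h1 i j).hasDerivAt⟩

/-- The second derivative of `√(det G)` at a point where its first derivative vanishes. -/
lemma hasDerivAt_deriv_sqrt_det {G G₁ : ℝ → Matrix ι ι ℝ} {G₂ : Matrix ι ι ℝ}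
    (h₁ : ∀ᶠ t in 𝓝 (0 : ℝ), ∀ i j, HasDerivAt (fun s ↦ G s i j) (G₁ t i j) t)
    (h₂ : ∀ i j, HasDerivAt (fun s ↦ G₁ s i j) (G₂ i j) 0)
    (hpos : ∀ᶠ t in 𝓝 (0 : ℝ), 0 < (G t).det) (htr : ((G 0)⁻¹ * G₁ 0).trace = 0) :
    HasDerivAt (deriv fun t ↦ √(G t).det)
      (√(G 0).det * ((1 / 2) * ((G 0)⁻¹ * G₂).trace
        - (1 / 2) * ((G 0)⁻¹ * G₁ 0 * ((G 0)⁻¹ * G₁ 0)).trace)) 0 := by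
  have hd : 0 < (G 0).det := hpos.self_of_nhds
  have hu : IsUnit (G 0).det := hd.ne'.isUnit
  have hadj : (G 0).adjugate = (G 0).det • (G 0)⁻¹ := by
    rw [Matrix.inv_def, smul_smul, Ring.mul_inverse_cancel _ hu, one_smul]
  have hG0 := h₁.self_of_nhds
  have hN0 : ((G 0).adjugate * G₁ 0).trace = 0 := by
    rw [hadj, Matrix.smul_mul, Matrix.trace_smul, htr, smul_zero]
  have hderiv : (deriv fun t ↦ √(G t).det) =ᶠ[𝓝 0]
      fun t ↦ ((G t).adjugate * G₁ t).trace / (2 * √(G t).det) := by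
    filter_upwards [h₁, hpos] with t ht hp
    exact ((hasDerivAt_det ht).sqrt hp.ne').deriv
  obtain ⟨R, hR⟩ := exists_hasDerivAt_adjugate hG0
  -- differentiate `adj G * G = det G` to find the derivative `R` of the adjugate
  have hRG : R * G 0 + (G 0).adjugate * G₁ 0 = 0 := by
    ext i j
    have e1 : HasDerivAt (fun s ↦ ((G s).adjugate * G s) i j)
        ((R * G 0 + (G 0).adjugate * G₁ 0) i j) 0 := by
      simp only [Matrix.mul_apply, Matrix.add_apply, ← Finset.sum_add_distrib]
      exact HasDerivAt.fun_sum fun k _ ↦ (hR i k).mul (hG0 k j)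
    have e2 : HasDerivAt (fun s ↦ ((G s).adjugate * G s) i j) 0 0 := by
      simp only [Matrix.adjugate_mul, Matrix.smul_apply]
      have := (hasDerivAt_det hG0).smul_const ((1 : Matrix ι ι ℝ) i j)
      rwa [hN0, zero_smul] at this
    exact e1.unique e2
  have hR' : R = -((G 0).det • ((G 0)⁻¹ * G₁ 0 * (G 0)⁻¹)) := by
    have : R * G 0 * (G 0)⁻¹ = -((G 0).adjugate * G₁ 0) * (G 0)⁻¹ := by
      rw [eq_neg_of_add_eq_zero_left hRG]
    rw [Matrix.mul_assoc, Matrix.mul_nonsing_inv _ hu, Matrix.mul_one, hadj] at this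
    rw [this]
    simp
  have hN : HasDerivAt (fun t ↦ ((G t).adjugate * G₁ t).trace)
      ((R * G₁ 0).trace + ((G 0).adjugate * G₂).trace) 0 := by
    simp only [Matrix.trace, Matrix.diag, Matrix.mul_apply, ← Finset.sum_add_distrib]
    exact HasDerivAt.fun_sum fun i _ ↦ HasDerivAt.fun_sum fun k _ ↦ (hR i k).mul (h₂ k i)
  have hs : 0 < √(G 0).det := Real.sqrt_pos.2 hd
  have h3 := hN.div (((hasDerivAt_det hG0).sqrt hd.ne').const_mul 2) (by positivity)
  refine (h3.congr_of_eventuallyEq hderiv).congr_deriv ?_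
  rw [hN0, hR', hadj]
  have hss : (G 0).det = √(G 0).det * √(G 0).det := (Real.mul_self_sqrt hd.le).symm
  simp only [Matrix.neg_mul, Matrix.smul_mul, Matrix.trace_neg, Matrix.trace_smul, smul_eq_mul,
    Matrix.mul_assoc, zero_mul, sub_zero]
  set s := √(G 0).det
  rw [hss]
  field_simp
  ring

/-- The square of an endomorphism that is symmetric with respect to a positive definite form has
nonnegative trace. -/
lemma trace_sq_nonneg {G a : Matrix ι ι ℝ} (hG : G.PosDef) (ha : a.transpose = a) :
    0 ≤ (G⁻¹ * a * (G⁻¹ * a)).trace := by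
  obtain ⟨C, hC⟩ : ∃ C : Matrix ι ι ℝ, G⁻¹ = C.transpose * C := by
    open scoped MatrixOrder in
    obtain ⟨C, hC⟩ := CStarAlgebra.nonneg_iff_eq_star_mul_self.1 hG.inv.posSemidef.nonneg
    exact ⟨C, by
      simpa [Matrix.star_eq_conjTranspose, Matrix.conjTranspose_eq_transpose_of_trivial] using hC⟩
  have h1 : (G⁻¹ * a * (G⁻¹ * a)).trace =
      ((C * a * C.transpose).transpose * (C * a * C.transpose)).trace := by
    rw [hC]
    simp only [Matrix.transpose_mul, Matrix.transpose_transpose, ha, Matrix.mul_assoc]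
    rw [Matrix.trace_mul_comm]
    simp only [Matrix.mul_assoc]
  rw [h1, Matrix.trace]
  exact Finset.sum_nonneg fun i _ ↦ by
    simp only [Matrix.diag, Matrix.mul_apply, Matrix.transpose_apply]
    exact Finset.sum_nonneg fun k _ ↦ mul_self_nonneg _

end Determinant

/-! ### The Gauss equation in the light-cone -/

section Gauss

variable {n : ℕ}

/-- The first fundamental form `(⟨∂ᵢp, ∂ⱼp⟩)` of a map `p` defined on a domain `T` of `ℝⁿ`. -/
noncomputable def gram (T : Set (EuclideanSpace ℝ (Fin n)))
    (p : EuclideanSpace ℝ (Fin n) → Minkowski n) (y : EuclideanSpace ℝ (Fin n)) :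
    Matrix (Fin n) (Fin n) ℝ :=
  Matrix.of fun i j ↦ minkowski (pd T (stdVec i) p y) (pd T (stdVec j) p y)

/-- The components `(⟨∂ᵢ∂ⱼp, q⟩)` of the second fundamental form in the direction of a normal vector
`q` at the point `y`. -/
noncomputable def shapeMatrix (T : Set (EuclideanSpace ℝ (Fin n)))
    (p : EuclideanSpace ℝ (Fin n) → Minkowski n) (q : Minkowski n)
    (y : EuclideanSpace ℝ (Fin n)) : Matrix (Fin n) (Fin n) ℝ :=
  Matrix.of fun i j ↦ minkowski (pd T (stdVec i) (pd T (stdVec j) p) y) q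

/-- The Christoffel symbols of the metric with matrix `G`, with derivatives within `T`. -/
noncomputable def localChristoffel (T : Set (EuclideanSpace ℝ (Fin n)))
    (G : EuclideanSpace ℝ (Fin n) → Matrix (Fin n) (Fin n) ℝ) (k i j : Fin n)
    (y : EuclideanSpace ℝ (Fin n)) : ℝ :=
  (1 / 2) * ∑ l, (G y)⁻¹ k l * (pd T (stdVec i) (fun z ↦ G z j l) y
    + pd T (stdVec j) (fun z ↦ G z i l) y - pd T (stdVec l) (fun z ↦ G z i j) y)

/-- The curvature components of the metric with matrix `G`, with derivatives within `T`. -/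
noncomputable def localCurvature (T : Set (EuclideanSpace ℝ (Fin n)))
    (G : EuclideanSpace ℝ (Fin n) → Matrix (Fin n) (Fin n) ℝ) (l k i j : Fin n)
    (y : EuclideanSpace ℝ (Fin n)) : ℝ :=
  pd T (stdVec i) (localChristoffel T G l j k) y - pd T (stdVec j) (localChristoffel T G l i k) y
    + ∑ m, (localChristoffel T G m j k y * localChristoffel T G l i m y
      - localChristoffel T G m i k y * localChristoffel T G l j m y)

section Smooth

variable {W : Type*} [NormedAddCommGroup W] [NormedSpace ℝ W] {S : Set W}
  {ι : Type*} [Fintype ι] [DecidableEq ι] {G : W → Matrix ι ι ℝ}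

lemma contDiffOn_det (hG : ∀ i j, ContDiffOn ℝ ∞ (fun y ↦ G y i j) S) :
    ContDiffOn ℝ ∞ (fun y ↦ (G y).det) S := by
  simp only [Matrix.det_apply']
  exact ContDiffOn.sum fun σ _ ↦ contDiffOn_const.mul (contDiffOn_prod fun i _ ↦ hG _ _)

lemma contDiffOn_inv (hG : ∀ i j, ContDiffOn ℝ ∞ (fun y ↦ G y i j) S)
    (h0 : ∀ y ∈ S, (G y).det ≠ 0) (i j : ι) :
    ContDiffOn ℝ ∞ (fun y ↦ (G y)⁻¹ i j) S := by
  simp only [Matrix.inv_def, Ring.inverse_eq_inv', Matrix.smul_apply, smul_eq_mul,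
    Matrix.adjugate_apply]
  refine ((contDiffOn_det hG).inv h0).mul (contDiffOn_det fun k l ↦ ?_)
  by_cases hk : k = j
  · subst hk
    simpa using contDiffOn_const
  · simpa [Matrix.updateRow_ne hk] using hG k l

end Smooth

variable {T : Set (EuclideanSpace ℝ (Fin n))} {p : EuclideanSpace ℝ (Fin n) → Minkowski n}

lemma gram_symm (y : EuclideanSpace ℝ (Fin n)) (i j : Fin n) :
    gram T p y i j = gram T p y j i := minkowski_comm _ _

lemma contDiffOn_gram (hT : IsRegularDomain T) (hp : ContDiffOn ℝ ∞ p T) (i j : Fin n) :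
    ContDiffOn ℝ ∞ (fun y ↦ gram T p y i j) T :=
  contDiffOn_minkowski (contDiffOn_pd hT hp _) (contDiffOn_pd hT hp _)

lemma contDiffOn_localChristoffel (hT : IsRegularDomain T) (hp : ContDiffOn ℝ ∞ p T)
    (h0 : ∀ y ∈ T, (gram T p y).det ≠ 0) (k i j : Fin n) :
    ContDiffOn ℝ ∞ (localChristoffel T (gram T p) k i j) T := by
  have hG := contDiffOn_gram hT hp
  have hd : ∀ i j l, ContDiffOn ℝ ∞ (pd T (stdVec i) (fun z ↦ gram T p z j l)) T :=
    fun i j l ↦ contDiffOn_pd hT (hG j l) _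
  exact contDiffOn_const.mul (ContDiffOn.sum fun l _ ↦ (contDiffOn_inv hG h0 k l).mul
    (((hd i j l).add (hd j i l)).sub (hd l i j)))

lemma pd_gram (hT : IsRegularDomain T) (hp : ContDiffOn ℝ ∞ p T) {y : EuclideanSpace ℝ (Fin n)}
    (hy : y ∈ T) (i j l : Fin n) :
    pd T (stdVec i) (fun z ↦ gram T p z j l) y =
      minkowski (pd T (stdVec i) (pd T (stdVec j) p) y) (pd T (stdVec l) p y)
      + minkowski (pd T (stdVec j) p y) (pd T (stdVec i) (pd T (stdVec l) p) y) :=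
  pd_minkowski hT (contDiffOn_pd hT hp _) (contDiffOn_pd hT hp _) hy

/-- The Christoffel symbols are the tangential components of the second derivatives. -/
lemma sum_localChristoffel_mul (hT : IsRegularDomain T) (hp : ContDiffOn ℝ ∞ p T)
    (h0 : ∀ y ∈ T, (gram T p y).det ≠ 0) {y : EuclideanSpace ℝ (Fin n)} (hy : y ∈ T)
    (j k l : Fin n) :
    ∑ m, localChristoffel T (gram T p) m j k y * gram T p y m l =
      minkowski (pd T (stdVec j) (pd T (stdVec k) p) y) (pd T (stdVec l) p y) := by
  set c : Fin n → ℝ := fun l ↦ pd T (stdVec j) (fun z ↦ gram T p z k l) y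
    + pd T (stdVec k) (fun z ↦ gram T p z j l) y - pd T (stdVec l) (fun z ↦ gram T p z j k) y
    with hc
  have h1 : (fun m ↦ localChristoffel T (gram T p) m j k y) =
      (1 / 2 : ℝ) • ((gram T p y)⁻¹.mulVec c) := by
    ext m
    simp [localChristoffel, Matrix.mulVec, dotProduct, hc]
  have h2 : ∑ m, localChristoffel T (gram T p) m j k y * gram T p y m l =
      (gram T p y).mulVec (fun m ↦ localChristoffel T (gram T p) m j k y) l := by
    simp only [Matrix.mulVec, dotProduct]
    exact Finset.sum_congr rfl fun m _ ↦ by rw [gram_symm y m l, mul_comm]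
  rw [h2, h1, Matrix.mulVec_smul, Matrix.mulVec_mulVec,
    Matrix.mul_nonsing_inv _ (h0 y hy).isUnit, Matrix.one_mulVec]
  simp only [Pi.smul_apply, smul_eq_mul, hc, pd_gram hT hp hy]
  rw [pd_comm hT hp hy (v := stdVec k) (w := stdVec j),
    pd_comm hT hp hy (v := stdVec l) (w := stdVec j),
    pd_comm hT hp hy (v := stdVec l) (w := stdVec k),
    minkowski_comm (pd T (stdVec k) p y)]
  rw [minkowski_comm (pd T (stdVec j) p y)]
  ring

variable {q : Minkowski n} {y : EuclideanSpace ℝ (Fin n)}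

lemma minkowski_pd_self (hT : IsRegularDomain T) (hp : ContDiffOn ℝ ∞ p T)
    (hpp : ∀ y ∈ T, minkowski (p y) (p y) = 0) (hy : y ∈ T) (v : EuclideanSpace ℝ (Fin n)) :
    minkowski (pd T v p y) (p y) = 0 := by
  have h := pd_minkowski (v := v) hT hp hp hy
  rw [pd_congr hpp hy, pd_const, minkowski_comm (p y)] at h
  linarith

/-- The component of the second fundamental form in the direction of the position vector. -/
lemma minkowski_pd_pd_self (hT : IsRegularDomain T) (hp : ContDiffOn ℝ ∞ p T)
    (hpp : ∀ y ∈ T, minkowski (p y) (p y) = 0) (hy : y ∈ T) (v w : EuclideanSpace ℝ (Fin n)) :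
    minkowski (pd T v (pd T w p) y) (p y) = -minkowski (pd T v p y) (pd T w p y) := by
  have h := pd_minkowski (v := v) hT (contDiffOn_pd hT hp w) hp hy
  rw [pd_congr (fun z hz ↦ minkowski_pd_self hT hp hpp hz w) hy, pd_const,
    minkowski_comm (pd T w p y)] at h
  linarith

lemma fderivWithin_apply_eq_sum (u : EuclideanSpace ℝ (Fin n) → Minkowski n)
    (v : EuclideanSpace ℝ (Fin n)) :
    fderivWithin ℝ u T y v = ∑ l, v l • pd T (stdVec l) u y := by
  conv_lhs => rw [← (EuclideanSpace.basisFun (Fin n) ℝ).sum_repr v]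
  simp [pd, stdVec]

lemma minkowski_fderivWithin_eq_zero {z : Minkowski n}
    (hz : ∀ l, minkowski z (pd T (stdVec l) p y) = 0) (v : EuclideanSpace ℝ (Fin n)) :
    minkowski z ((fderivWithin ℝ p T y).toLinearMap v) = 0 := by
  change minkowski z (fderivWithin ℝ p T y v) = 0
  rw [fderivWithin_apply_eq_sum, minkowski_sum_right]
  exact Finset.sum_eq_zero fun l _ ↦ by rw [minkowski_smul_right, hz, mul_zero]

/-- The Gauss formula: the normal part of the second derivative of a map into the light-cone. -/
lemma gauss_formula (hT : IsRegularDomain T) (hp : ContDiffOn ℝ ∞ p T)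
    (hpp : ∀ y ∈ T, minkowski (p y) (p y) = 0) (h0 : ∀ y ∈ T, (gram T p y).det ≠ 0) (hy : y ∈ T)
    (hq : IsNullFrame (fderivWithin ℝ p T y).toLinearMap (p y) q) (j k : Fin n) :
    pd T (stdVec j) (pd T (stdVec k) p) y
        - ∑ m, localChristoffel T (gram T p) m j k y • pd T (stdVec m) p y =
      shapeMatrix T p q y j k • p y - gram T p y j k • q := by
  have hpq : ∀ m, minkowski (pd T (stdVec m) p y) q = 0 := fun m ↦ hq.Lq _
  rw [hq.eq_add (by simp) (z := pd T (stdVec j) (pd T (stdVec k) p) y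
        - ∑ m, localChristoffel T (gram T p) m j k y • pd T (stdVec m) p y)]
  · simp only [minkowski_sub_left, minkowski_sum_left, minkowski_smul_left, hpq,
      minkowski_pd_self hT hp hpp hy, minkowski_pd_pd_self hT hp hpp hy]
    simp [shapeMatrix, gram, sub_eq_add_neg]
  · refine minkowski_fderivWithin_eq_zero fun l ↦ ?_
    rw [minkowski_sub_left, minkowski_sum_left,
      ← sum_localChristoffel_mul hT hp h0 hy]
    simp [minkowski_smul_left, gram]

/-- One half of the Gauss equation; the other half follows by exchanging `i` and `j`. -/
lemma sum_pd_localChristoffel_mul (hT : IsRegularDomain T) (hp : ContDiffOn ℝ ∞ p T)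
    (hpp : ∀ y ∈ T, minkowski (p y) (p y) = 0) (h0 : ∀ y ∈ T, (gram T p y).det ≠ 0) (hy : y ∈ T)
    (hq : IsNullFrame (fderivWithin ℝ p T y).toLinearMap (p y) q) (i j k l : Fin n) :
    ∑ m, (pd T (stdVec i) (localChristoffel T (gram T p) m j k) y
        + ∑ r, localChristoffel T (gram T p) r j k y * localChristoffel T (gram T p) m i r y)
        * gram T p y m l =
      minkowski (pd T (stdVec i) (pd T (stdVec j) (pd T (stdVec k) p)) y) (pd T (stdVec l) p y)
        - shapeMatrix T p q y j k * gram T p y i l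
        - gram T p y j k * shapeMatrix T p q y i l := by
  have hΓ := contDiffOn_localChristoffel hT hp h0
  have hG := contDiffOn_gram hT hp
  -- differentiate `∑ Γᵐⱼₖ Gₘₗ = ⟨∂ⱼ∂ₖp, ∂ₗp⟩` in the direction `i`
  have e1 : ∑ m, (pd T (stdVec i) (localChristoffel T (gram T p) m j k) y * gram T p y m l
        + localChristoffel T (gram T p) m j k y * pd T (stdVec i) (fun z ↦ gram T p z m l) y) =
      minkowski (pd T (stdVec i) (pd T (stdVec j) (pd T (stdVec k) p)) y) (pd T (stdVec l) p y)
      + minkowski (pd T (stdVec j) (pd T (stdVec k) p) y)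
        (pd T (stdVec i) (pd T (stdVec l) p) y) := by
    rw [← pd_minkowski hT (contDiffOn_pd hT (contDiffOn_pd hT hp _) _)
      (contDiffOn_pd hT hp _) hy,
      ← pd_congr (fun z hz ↦ sum_localChristoffel_mul hT hp h0 hz j k l) hy,
      pd_sum hT _ (fun m ↦ (hΓ m j k).mul (hG m l)) hy]
    exact Finset.sum_congr rfl fun m _ ↦ (pd_mul hT (hΓ m j k) (hG m l) hy).symm
  -- the normal parts of the two second derivatives
  have e2 : minkowski (pd T (stdVec j) (pd T (stdVec k) p) y)
        (pd T (stdVec i) (pd T (stdVec l) p) y)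
      - ∑ m, localChristoffel T (gram T p) m j k y *
        minkowski (pd T (stdVec m) p y) (pd T (stdVec i) (pd T (stdVec l) p) y) =
      - shapeMatrix T p q y j k * gram T p y i l - gram T p y j k * shapeMatrix T p q y i l := by
    have h := congrArg (fun x ↦ minkowski x (pd T (stdVec i) (pd T (stdVec l) p) y))
      (gauss_formula hT hp hpp h0 hy hq j k)
    simp only [minkowski_sub_left, minkowski_sum_left, minkowski_smul_left] at h
    rw [h, minkowski_comm (p y), minkowski_pd_pd_self hT hp hpp hy, minkowski_comm q]
    simp only [shapeMatrix, gram, Matrix.of_apply]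
    ring
  have e3 : ∑ m, (∑ r, localChristoffel T (gram T p) r j k y *
        localChristoffel T (gram T p) m i r y) * gram T p y m l =
      ∑ m, localChristoffel T (gram T p) m j k y *
        minkowski (pd T (stdVec i) (pd T (stdVec m) p) y) (pd T (stdVec l) p y) := by
    simp only [← sum_localChristoffel_mul hT hp h0 hy, Finset.sum_mul, Finset.mul_sum]
    rw [Finset.sum_comm]
    exact Finset.sum_congr rfl fun m _ ↦ Finset.sum_congr rfl fun r _ ↦ by ring
  simp only [pd_gram hT hp hy, mul_add, Finset.sum_add_distrib] at e1
  simp only [add_mul, Finset.sum_add_distrib, e3]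
  linarith

/-- The Gauss equation for a spacelike hypersurface of the light-cone. -/
lemma gauss_equation (hT : IsRegularDomain T) (hp : ContDiffOn ℝ ∞ p T)
    (hpp : ∀ y ∈ T, minkowski (p y) (p y) = 0) (h0 : ∀ y ∈ T, (gram T p y).det ≠ 0) (hy : y ∈ T)
    (hq : IsNullFrame (fderivWithin ℝ p T y).toLinearMap (p y) q) (i j k l : Fin n) :
    ∑ m, localCurvature T (gram T p) m k i j y * gram T p y m l =
      - shapeMatrix T p q y j k * gram T p y i l - gram T p y j k * shapeMatrix T p q y i l
      + shapeMatrix T p q y i k * gram T p y j l + gram T p y i k * shapeMatrix T p q y j l := by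
  have h1 := sum_pd_localChristoffel_mul hT hp hpp h0 hy hq i j k l
  have h2 := sum_pd_localChristoffel_mul hT hp hpp h0 hy hq j i k l
  rw [pd_comm hT (contDiffOn_pd hT hp _) hy] at h2
  have h3 : ∑ m, localCurvature T (gram T p) m k i j y * gram T p y m l =
      ∑ m, (pd T (stdVec i) (localChristoffel T (gram T p) m j k) y
        + ∑ r, localChristoffel T (gram T p) r j k y * localChristoffel T (gram T p) m i r y)
        * gram T p y m l
      - ∑ m, (pd T (stdVec j) (localChristoffel T (gram T p) m i k) y
        + ∑ r, localChristoffel T (gram T p) r i k y * localChristoffel T (gram T p) m j r y)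
        * gram T p y m l := by
    rw [← Finset.sum_sub_distrib]
    refine Finset.sum_congr rfl fun m _ ↦ ?_
    rw [localCurvature, Finset.sum_sub_distrib]
    ring
  rw [h3, h1, h2]
  ring

lemma shapeMatrix_symm (hT : IsRegularDomain T) (hp : ContDiffOn ℝ ∞ p T) (hy : y ∈ T)
    (i j : Fin n) : shapeMatrix T p q y i j = shapeMatrix T p q y j i := by
  simp only [shapeMatrix, Matrix.of_apply]
  rw [pd_comm hT hp hy]

/-- The scalar curvature of a spacelike hypersurface of the light-cone is `-2(n-1) tr A`. -/
lemma scalar_curvature_eq (hT : IsRegularDomain T) (hp : ContDiffOn ℝ ∞ p T)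
    (hpp : ∀ y ∈ T, minkowski (p y) (p y) = 0) (h0 : ∀ y ∈ T, (gram T p y).det ≠ 0) (hy : y ∈ T)
    (hq : IsNullFrame (fderivWithin ℝ p T y).toLinearMap (p y) q) :
    ∑ j, ∑ k, (gram T p y)⁻¹ j k * ∑ i, localCurvature T (gram T p) i k i j y =
      -2 * (n - 1) * ((gram T p y)⁻¹ * shapeMatrix T p q y).trace := by
  set G := gram T p y with hG
  set a := shapeMatrix T p q y with ha
  have hu : IsUnit G.det := (h0 y hy).isUnit
  have hGt : G.transpose = G := by ext i j; exact gram_symm y j i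
  have hat : a.transpose = a := by ext i j; exact shapeMatrix_symm hT hp hy j i
  have hR : ∀ k i j m, localCurvature T (gram T p) m k i j y =
      - a j k * (1 : Matrix (Fin n) (Fin n) ℝ) i m - G j k * (a * G⁻¹) i m
      + a i k * (1 : Matrix (Fin n) (Fin n) ℝ) j m + G i k * (a * G⁻¹) j m := by
    intro k i j m
    have h1 : Matrix.vecMul (fun m ↦ localCurvature T (gram T p) m k i j y) G =
        - a j k • G i - G j k • a i + a i k • G j + G i k • a j := by
      ext l
      exact gauss_equation hT hp hpp h0 hy hq i j k l
    have h2 := congrArg (fun v ↦ Matrix.vecMul v G⁻¹ m) h1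
    simp only [Matrix.vecMul_vecMul, Matrix.mul_nonsing_inv _ hu, Matrix.vecMul_one,
      Matrix.add_vecMul, Matrix.sub_vecMul, Matrix.smul_vecMul, Pi.add_apply, Pi.sub_apply,
      Pi.smul_apply, smul_eq_mul] at h2
    have h3 : ∀ (B : Matrix (Fin n) (Fin n) ℝ) i, Matrix.vecMul (B i) G⁻¹ m = (B * G⁻¹) i m :=
      fun B i ↦ (Matrix.mul_apply_eq_vecMul B G⁻¹ i ▸ rfl)
    rw [h3, h3, h3, h3, Matrix.mul_nonsing_inv _ hu] at h2
    exact h2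
  have hRic : ∀ j k, ∑ i, localCurvature T (gram T p) i k i j y =
      (2 - n) * a j k - (a * G⁻¹).trace * G j k := by
    intro j k
    have e1 : ∑ i, G i k * (a * G⁻¹) j i = a j k := by
      have : (a * G⁻¹ * G) j k = a j k := by
        rw [Matrix.mul_assoc, Matrix.nonsing_inv_mul _ hu, Matrix.mul_one]
      rw [← this, Matrix.mul_apply]
      exact Finset.sum_congr rfl fun i _ ↦ mul_comm _ _
    simp only [hR, Finset.sum_add_distrib, Finset.sum_sub_distrib, e1, ← Finset.mul_sum]
    simp [Matrix.one_apply, Matrix.trace]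
    ring
  have hsum : ∀ B : Matrix (Fin n) (Fin n) ℝ, B.transpose = B →
      ∑ j, ∑ k, G⁻¹ j k * B j k = (G⁻¹ * B).trace := by
    intro B hB
    simp only [Matrix.trace, Matrix.diag, Matrix.mul_apply]
    refine Finset.sum_congr rfl fun j _ ↦ Finset.sum_congr rfl fun k _ ↦ ?_
    rw [← hB, Matrix.transpose_apply, hB]
  have hfin : ∀ j k, G⁻¹ j k * ∑ i, localCurvature T (gram T p) i k i j y =
      (2 - n) * (G⁻¹ j k * a j k) - (a * G⁻¹).trace * (G⁻¹ j k * G j k) := by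
    intro j k
    rw [hRic]
    ring
  simp only [hfin, Finset.sum_sub_distrib, ← Finset.mul_sum]
  rw [hsum a hat, hsum G hGt, Matrix.nonsing_inv_mul _ hu, Matrix.trace_mul_comm a]
  simp
  ring

end Gauss

/-! ### The second variation of the volume density -/

section Variation

variable {n : ℕ} {T : Set (EuclideanSpace ℝ (Fin n))}
  {p X : EuclideanSpace ℝ (Fin n) → Minkowski n} {q : EuclideanSpace ℝ (Fin n) → Minkowski n}
  {φ ψ : EuclideanSpace ℝ (Fin n) → ℝ} {y : EuclideanSpace ℝ (Fin n)}

/-- The derivative of a field `φ q` in the direction of the dual map has tangential part `-φ A`.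
No differentiability of `q` or of `φ` is needed. -/
lemma minkowski_pd_normal_tangent (hT : IsRegularDomain T) (hp : ContDiffOn ℝ ∞ p T)
    (hq : ∀ y ∈ T, IsNullFrame (fderivWithin ℝ p T y).toLinearMap (p y) (q y))
    (hX : ContDiffOn ℝ ∞ X T) (hXq : ∀ y ∈ T, X y = φ y • q y) (hy : y ∈ T) (i j : Fin n) :
    minkowski (pd T (stdVec i) X y) (pd T (stdVec j) p y) =
      -φ y * shapeMatrix T p (q y) y i j := by
  have h := pd_minkowski (v := stdVec i) hT hX (contDiffOn_pd hT hp (stdVec j)) hy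
  have h0 : ∀ z ∈ T, minkowski (X z) (pd T (stdVec j) p z) = 0 := fun z hz ↦ by
    rw [hXq z hz, minkowski_smul_left, minkowski_comm, show minkowski (pd T _ p z) (q z) = 0 from
      (hq z hz).Lq _, mul_zero]
  rw [pd_congr h0 hy, pd_const, hXq y hy, minkowski_smul_left, minkowski_comm (q y)] at h
  simp only [shapeMatrix, Matrix.of_apply]
  linarith

/-- The inner products of the derivatives of a field `φ q` are given by `φ² A²`. Where `φ` vanishes
this follows from `⟨φ q, φ q⟩ = 0`, differentiated twice. -/
lemma minkowski_pd_normal (hT : IsRegularDomain T) (hp : ContDiffOn ℝ ∞ p T)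
    (hq : ∀ y ∈ T, IsNullFrame (fderivWithin ℝ p T y).toLinearMap (p y) (q y))
    (h0 : ∀ y ∈ T, (gram T p y).det ≠ 0)
    (hX : ContDiffOn ℝ ∞ X T) (hXq : ∀ y ∈ T, X y = φ y • q y) (hy : y ∈ T) (i j : Fin n) :
    minkowski (pd T (stdVec i) X y) (pd T (stdVec j) X y) =
      φ y ^ 2 * (shapeMatrix T p (q y) y * ((gram T p y)⁻¹ * shapeMatrix T p (q y) y)) i j := by
  have hXX : ∀ z ∈ T, minkowski (X z) (X z) = 0 := fun z hz ↦ by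
    rw [hXq z hz, minkowski_smul_left, minkowski_smul_right, (hq z hz).qq, mul_zero, mul_zero]
  by_cases hφ : φ y = 0
  · have h1 := minkowski_pd_pd_self hT hX hXX hy (stdVec i) (stdVec j)
    rw [hXq y hy, hφ, zero_smul, minkowski_zero_right] at h1
    rw [hφ]
    linarith
  set a := shapeMatrix T p (q y) y with ha
  set B := (gram T p y)⁻¹ * a with hB
  have hGB : gram T p y * B = a := by
    rw [hB, ← Matrix.mul_assoc, Matrix.mul_nonsing_inv _ (h0 y hy).isUnit, Matrix.one_mul]
  have hXt := minkowski_pd_normal_tangent hT hp hq hX hXq hy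
  have hXn : ∀ i, minkowski (pd T (stdVec i) X y) (q y) = 0 := fun i ↦ by
    have h1 := minkowski_pd_self hT hX hXX hy (stdVec i)
    rw [hXq y hy, minkowski_smul_right] at h1
    exact (mul_eq_zero.1 h1).resolve_left hφ
  -- `w` is the tangential part of `∂ⱼX`
  obtain ⟨w, hw⟩ : ∃ w, w = -φ y • ∑ k, B k j • pd T (stdVec k) p y := ⟨_, rfl⟩
  have hwq : minkowski w (q y) = 0 := by
    rw [hw, minkowski_smul_left, minkowski_sum_left]
    refine mul_eq_zero_of_right _ (Finset.sum_eq_zero fun k _ ↦ ?_)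
    rw [minkowski_smul_left, show minkowski (pd T _ p y) (q y) = 0 from (hq y hy).Lq _, mul_zero]
  have hzt : ∀ l, minkowski (pd T (stdVec j) X y - w) (pd T (stdVec l) p y) = 0 := by
    intro l
    rw [minkowski_sub_left, hXt, hw, minkowski_smul_left, minkowski_sum_left]
    have : ∑ k, minkowski (B k j • pd T (stdVec k) p y) (pd T (stdVec l) p y) = a j l := by
      rw [ha, shapeMatrix_symm hT hp hy, ← ha, ← hGB, Matrix.mul_apply]
      refine Finset.sum_congr rfl fun k _ ↦ ?_
      rw [minkowski_smul_left, gram_symm, mul_comm]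
      rfl
    rw [this]
    ring
  have hz := (hq y hy).eq_add (by simp) (minkowski_fderivWithin_eq_zero hzt)
  rw [minkowski_sub_left _ _ (q y), hXn, hwq, sub_zero, zero_smul, zero_add] at hz
  have hXw : minkowski (pd T (stdVec i) X y) w = φ y ^ 2 * (a * B) i j := by
    rw [hw, minkowski_smul_right, minkowski_sum_right, Matrix.mul_apply, Finset.mul_sum,
      Finset.mul_sum]
    refine Finset.sum_congr rfl fun k _ ↦ ?_
    rw [minkowski_smul_right, hXt]
    ring
  have hsplit : minkowski (pd T (stdVec i) X y) (pd T (stdVec j) X y) =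
      minkowski (pd T (stdVec i) X y) w
        + minkowski (pd T (stdVec i) X y) (pd T (stdVec j) X y - w) := by
    rw [minkowski_sub_right]
    ring
  rw [hsplit, hz, minkowski_smul_right, hXn, hXw, mul_zero, add_zero]

/-- The matrices of the metrics induced by a family `f t` of maps, as a function on `I × T`. -/
noncomputable def familyGram (S : Set (ℝ × EuclideanSpace ℝ (Fin n)))
    (f : ℝ × EuclideanSpace ℝ (Fin n) → Minkowski n) (z : ℝ × EuclideanSpace ℝ (Fin n)) :
    Matrix (Fin n) (Fin n) ℝ :=
  Matrix.of fun i j ↦ minkowski (pd S ((0 : ℝ), stdVec i) f z) (pd S ((0 : ℝ), stdVec j) f z)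

variable {I : Set ℝ} {f : ℝ × EuclideanSpace ℝ (Fin n) → Minkowski n}

lemma contDiffOn_familyGram {S : Set (ℝ × EuclideanSpace ℝ (Fin n))} (hS : IsRegularDomain S)
    (hf : ContDiffOn ℝ ∞ f S) (i j : Fin n) :
    ContDiffOn ℝ ∞ (fun z ↦ familyGram S f z i j) S :=
  contDiffOn_minkowski (contDiffOn_pd hS hf _) (contDiffOn_pd hS hf _)

lemma familyGram_eq (hT : IsRegularDomain T) (hf : ContDiffOn ℝ ∞ f (I ×ˢ T)) {t : ℝ}
    (ht : t ∈ I) (hy : y ∈ T) :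
    familyGram (I ×ˢ T) f (t, y) = gram T (fun y ↦ f (t, y)) y := by
  ext i j
  simp only [familyGram, gram, Matrix.of_apply, pd_slice hT.uniqueDiffOn hf ht hy]

/-- The second variation of the volume density at a point where the trace of the shape operator
vanishes. -/
lemma hasDerivAt_deriv_density (hI : IsOpen I) (h0I : (0 : ℝ) ∈ I) (hT : IsRegularDomain T)
    (hf : ContDiffOn ℝ ∞ f (I ×ˢ T)) (hfp : ∀ y ∈ T, f (0, y) = p y)
    (hdet : ∀ z ∈ I ×ˢ T, 0 < (familyGram (I ×ˢ T) f z).det)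
    (hq : ∀ y ∈ T, IsNullFrame (fderivWithin ℝ p T y).toLinearMap (p y) (q y))
    (hφ : ∀ y ∈ T, deriv (fun t ↦ f (t, y)) 0 = φ y • q y)
    (hψ : ∀ y ∈ T, deriv (fun t ↦ deriv (fun s ↦ f (s, y)) t) 0 = ψ y • q y)
    (hy : y ∈ T) (htr : ((gram T p y)⁻¹ * shapeMatrix T p (q y) y).trace = 0) :
    HasDerivAt (deriv fun t ↦ √(familyGram (I ×ˢ T) f (t, y)).det)
      (-(φ y ^ 2 * ((gram T p y)⁻¹ * shapeMatrix T p (q y) y *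
        ((gram T p y)⁻¹ * shapeMatrix T p (q y) y)).trace) * √(gram T p y).det) 0 := by
  set S := I ×ˢ T with hSdef
  have hS : IsRegularDomain S := hT.prod hI
  have hmem : ∀ y ∈ T, ((0 : ℝ), y) ∈ S := fun y hy ↦ ⟨h0I, hy⟩
  have hinc : ContDiff ℝ ∞ fun y : EuclideanSpace ℝ (Fin n) ↦ ((0 : ℝ), y) :=
    contDiff_const.prodMk contDiff_id
  set e₀ : ℝ × EuclideanSpace ℝ (Fin n) := (1, 0) with he₀
  set e : Fin n → ℝ × EuclideanSpace ℝ (Fin n) := fun i ↦ (0, stdVec i) with he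
  have hf₁ : ContDiffOn ℝ ∞ (pd S e₀ f) S := contDiffOn_pd hS hf _
  have hf₂ : ContDiffOn ℝ ∞ (pd S e₀ (pd S e₀ f)) S := contDiffOn_pd hS hf₁ _
  have hfi : ∀ i, ContDiffOn ℝ ∞ (pd S (e i) f) S := fun i ↦ contDiffOn_pd hS hf _
  have hf₀i : ∀ i, ContDiffOn ℝ ∞ (pd S e₀ (pd S (e i) f)) S := fun i ↦ contDiffOn_pd hS (hfi i) _
  have hp : ContDiffOn ℝ ∞ p T :=
    (hf.comp hinc.contDiffOn hmem).congr fun y hy ↦ (hfp y hy).symm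
  have hgram : familyGram S f (0, y) = gram T p y := by
    rw [familyGram_eq hT hf h0I hy]
    ext i j
    simp only [gram, Matrix.of_apply, pd_congr hfp hy]
  have hG0 : ∀ y ∈ T, (gram T p y).det ≠ 0 := by
    intro z hz
    have h1 := hdet (0, z) (hmem z hz)
    rw [familyGram_eq hT hf h0I hz] at h1
    have h2 : gram T (fun y ↦ f (0, y)) z = gram T p z := by
      ext i j
      simp only [gram, Matrix.of_apply, pd_congr hfp hz]
    exact h2 ▸ h1.ne'
  -- the variational vector field and the acceleration, as functions on `T`
  set X : EuclideanSpace ℝ (Fin n) → Minkowski n := fun y ↦ pd S e₀ f (0, y) with hXdef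
  set Y : EuclideanSpace ℝ (Fin n) → Minkowski n := fun y ↦ pd S e₀ (pd S e₀ f) (0, y) with hYdef
  have hX : ContDiffOn ℝ ∞ X T := hf₁.comp hinc.contDiffOn hmem
  have hY : ContDiffOn ℝ ∞ Y T := hf₂.comp hinc.contDiffOn hmem
  have hXq : ∀ y ∈ T, X y = φ y • q y := fun y hy ↦ by
    rw [← hφ y hy, (hasDerivAt_slice hI hf h0I hy).deriv]
  have hYq : ∀ y ∈ T, Y y = ψ y • q y := fun y hy ↦ by
    rw [← hψ y hy]
    have : (fun t ↦ deriv (fun s ↦ f (s, y)) t) =ᶠ[𝓝 0] fun t ↦ pd S e₀ f (t, y) := by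
      filter_upwards [hI.mem_nhds h0I] with t ht
      exact (hasDerivAt_slice hI hf ht hy).deriv
    rw [this.deriv_eq, (hasDerivAt_slice hI hf₁ h0I hy).deriv]
  have hz := hmem y hy
  have hpi : ∀ i, pd S (e i) f (0, y) = pd T (stdVec i) p y := fun i ↦ by
    rw [← pd_congr hfp hy, pd_slice hT.uniqueDiffOn hf h0I hy]
  have hXi : ∀ i, pd S e₀ (pd S (e i) f) (0, y) = pd T (stdVec i) X y := fun i ↦ by
    rw [pd_comm hS hf hz, pd_slice hT.uniqueDiffOn hf₁ h0I hy]
  have hYi : ∀ i, pd S e₀ (pd S e₀ (pd S (e i) f)) (0, y) = pd T (stdVec i) Y y := fun i ↦ by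
    rw [pd_congr (fun z hz ↦ pd_comm hS hf hz) hz, pd_comm hS hf₁ hz,
      pd_slice hT.uniqueDiffOn hf₂ h0I hy]
  have hΓ := contDiffOn_familyGram hS hf
  set a := shapeMatrix T p (q y) y with ha
  set G := gram T p y with hG
  have hat : ∀ i j, a i j = a j i := shapeMatrix_symm hT hp hy
  have hd1 : ∀ z ∈ S, ∀ i j, pd S e₀ (fun z ↦ familyGram S f z i j) z =
      minkowski (pd S e₀ (pd S (e i) f) z) (pd S (e j) f z)
      + minkowski (pd S (e i) f z) (pd S e₀ (pd S (e j) f) z) :=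
    fun z hz i j ↦ pd_minkowski hS (hfi i) (hfi j) hz
  set G₁ : ℝ → Matrix (Fin n) (Fin n) ℝ :=
    fun t ↦ Matrix.of fun i j ↦ pd S e₀ (fun z ↦ familyGram S f z i j) (t, y) with hG₁
  set G₂ : Matrix (Fin n) (Fin n) ℝ :=
    Matrix.of fun i j ↦ pd S e₀ (pd S e₀ (fun z ↦ familyGram S f z i j)) (0, y) with hG₂
  have hG₁0 : G₁ 0 = (-2 * φ y) • a := by
    ext i j
    simp only [hG₁, Matrix.of_apply, hd1 _ hz, hXi, hpi, Matrix.smul_apply, smul_eq_mul]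
    rw [minkowski_comm (pd T (stdVec i) p y), minkowski_pd_normal_tangent hT hp hq hX hXq hy,
      minkowski_pd_normal_tangent hT hp hq hX hXq hy, ← ha, hat j i]
    ring
  have hG₂0 : G₂ = (-2 * ψ y) • a + (2 * φ y ^ 2) • (a * (G⁻¹ * a)) := by
    ext i j
    have e1 : pd S e₀ (pd S e₀ (fun z ↦ familyGram S f z i j)) (0, y) =
        (minkowski (pd S e₀ (pd S e₀ (pd S (e i) f)) (0, y)) (pd S (e j) f (0, y))
        + minkowski (pd S e₀ (pd S (e i) f) (0, y)) (pd S e₀ (pd S (e j) f) (0, y)))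
        + (minkowski (pd S e₀ (pd S (e i) f) (0, y)) (pd S e₀ (pd S (e j) f) (0, y))
        + minkowski (pd S (e i) f (0, y)) (pd S e₀ (pd S e₀ (pd S (e j) f)) (0, y))) := by
      rw [pd_congr (fun z hz ↦ hd1 z hz i j) hz, ← pd_minkowski hS (hf₀i i) (hfi j) hz,
        ← pd_minkowski hS (hfi i) (hf₀i j) hz, pd, fderivWithin_fun_add (hS.uniqueDiffOn _ hz)
        ((contDiffOn_minkowski (hf₀i i) (hfi j) _ hz).differentiableWithinAt (by simp))
        ((contDiffOn_minkowski (hfi i) (hf₀i j) _ hz).differentiableWithinAt (by simp))]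
      rfl
    simp only [hG₂, Matrix.of_apply, e1, hXi, hYi, hpi, Matrix.add_apply, Matrix.smul_apply,
      smul_eq_mul]
    rw [minkowski_comm (pd T (stdVec i) p y), minkowski_pd_normal_tangent hT hp hq hY hYq hy,
      minkowski_pd_normal_tangent hT hp hq hY hYq hy,
      minkowski_pd_normal hT hp hq hG0 hX hXq hy, ← ha, hat j i]
    ring
  have hder := hasDerivAt_deriv_sqrt_det (G := fun t ↦ familyGram S f (t, y)) (G₁ := G₁) (G₂ := G₂)
    (by
      filter_upwards [hI.mem_nhds h0I] with t ht i j
      exact hasDerivAt_slice hI (hΓ i j) ht hy)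
    (fun i j ↦ hasDerivAt_slice hI (contDiffOn_pd hS (hΓ i j) e₀) h0I hy)
    (by
      filter_upwards [hI.mem_nhds h0I] with t ht
      exact hdet _ ⟨ht, hy⟩)
    (by rw [hgram, hG₁0, Matrix.mul_smul, Matrix.trace_smul, htr, smul_zero])
  refine hder.congr_deriv ?_
  rw [hgram, hG₁0, hG₂0]
  simp only [Matrix.mul_add, Matrix.mul_smul, Matrix.smul_mul, Matrix.trace_add, Matrix.trace_smul,
    htr, smul_eq_mul]
  rw [← Matrix.mul_assoc G⁻¹ a]
  ring

end Variation

/-! ### Passing to charts -/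

section ChartChange

variable {n : ℕ} {W W' : Type*} [NormedAddCommGroup W] [NormedSpace ℝ W]
  [NormedAddCommGroup W'] [NormedSpace ℝ W'] {S : Set W} {S' : Set W'}

/-- Under a change of parameters, the normal part of the second derivative is tensorial. -/
lemma minkowski_pd_pd_comp (hS : IsRegularDomain S) (hS' : IsRegularDomain S')
    {f : W' → Minkowski n} (hf : ContDiffOn ℝ ∞ f S') {τ : W → W'} (hτ : ContDiffOn ℝ ∞ τ S)
    (hm : MapsTo τ S S') {z : W} (hz : z ∈ S) {q : Minkowski n}
    (hq : ∀ w, minkowski (pd S' w f (τ z)) q = 0) (v w : W) :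
    minkowski (pd S v (pd S w (f ∘ τ)) z) q =
      minkowski (pd S' (pd S v τ z) (pd S' (pd S w τ z) f) (τ z)) q := by
  have dτ : ∀ y ∈ S, HasFDerivWithinAt τ (fderivWithin ℝ τ S y) S y := fun y hy ↦
    ((hτ y hy).differentiableWithinAt (by simp)).hasFDerivWithinAt
  have h1 : ∀ y ∈ S, pd S w (f ∘ τ) y = fderivWithin ℝ f S' (τ y) (pd S w τ y) := by
    intro y hy
    have d := ((hf (τ y) (hm hy)).differentiableWithinAt (by simp)).hasFDerivWithinAt
    rw [pd, (d.comp y (dτ y hy) hm).fderivWithin (hS.uniqueDiffOn y hy)]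
    rfl
  have d1 : HasFDerivWithinAt (fun y ↦ fderivWithin ℝ f S' y)
      (fderivWithin ℝ (fun y ↦ fderivWithin ℝ f S' y) S' (τ z)) S' (τ z) :=
    (((hf.fderivWithin hS'.uniqueDiffOn (m := ∞) (by simp)) _ (hm hz)).differentiableWithinAt
      (by simp)).hasFDerivWithinAt
  have d2 := (((contDiffOn_pd hS hτ w) z hz).differentiableWithinAt (by simp)).hasFDerivWithinAt
  have d3 := ((d1.comp z (dτ z hz) hm).clm_apply d2).fderivWithin (hS.uniqueDiffOn z hz)
  rw [pd_congr h1 hz, pd_pd hS' hf (hm hz), pd]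
  have d4 : (fun y ↦ fderivWithin ℝ f S' (τ y) (pd S w τ y)) =
      fun y ↦ ((fun y ↦ fderivWithin ℝ f S' y) ∘ τ) y (pd S w τ y) := rfl
  rw [d4, d3]
  simp only [_root_.add_apply, ContinuousLinearMap.comp_apply,
    ContinuousLinearMap.flip_apply, minkowski_add_left, Function.comp_apply]
  have := hq (fderivWithin ℝ (pd S w τ) S z v)
  rw [pd] at this
  rw [this, zero_add]
  rfl

lemma pd_inter {X : Type*} [NormedAddCommGroup X] [NormedSpace ℝ X] {U : Set W} (hU : IsOpen U)
    {z : W} (hz : z ∈ U) (v : W) (u : W → X) : pd (S ∩ U) v u z = pd S v u z := by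
  rw [pd, pd, fderivWithin_inter (hU.mem_nhds hz)]

lemma IsRegularDomain.inter (hS : IsRegularDomain S) {U : Set W} (hU : IsOpen U) :
    IsRegularDomain (S ∩ U) where
  uniqueDiffOn := hS.uniqueDiffOn.inter hU
  subset_closure := fun z hz ↦ by
    rw [interior_inter, hU.interior_eq]
    exact hU.closure_inter ⟨hS.subset_closure hz.1, hz.2⟩

lemma posDef_gram {T : Set (EuclideanSpace ℝ (Fin n))}
    {f : EuclideanSpace ℝ (Fin n) → Minkowski n} {y : EuclideanSpace ℝ (Fin n)}
    (h : ∀ v : EuclideanSpace ℝ (Fin n), v ≠ 0 → 0 < minkowski (pd T v f y) (pd T v f y)) :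
    (gram T f y).PosDef := by
  refine Matrix.PosDef.of_dotProduct_mulVec_pos ?_ fun v hv ↦ ?_
  · exact Matrix.IsHermitian.ext fun i j ↦ by rw [star_trivial, gram_symm]
  · have h1 := h (WithLp.toLp 2 v) (by simpa using hv)
    have h2 : pd T (WithLp.toLp 2 v) f y = ∑ l, v l • pd T (stdVec l) f y :=
      fderivWithin_apply_eq_sum _ _
    rw [h2, minkowski_sum_left] at h1
    refine h1.trans_eq ?_
    simp only [dotProduct, Matrix.mulVec, gram, Matrix.of_apply, minkowski_smul_left,
      minkowski_sum_right, minkowski_smul_right, star_trivial]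
    refine Finset.sum_congr rfl fun i _ ↦ ?_
    rw [Finset.mul_sum]
    exact Finset.sum_congr rfl fun j _ ↦ by ring

/-- The traces of the shape operator and of its square can be computed from the matrices of the
first and second fundamental forms in any parametrization `f ∘ τ`. -/
lemma trace_shapeMatrix_comp {S S' : Set (EuclideanSpace ℝ (Fin n))} (hS : IsRegularDomain S)
    (hS' : IsRegularDomain S') {f : EuclideanSpace ℝ (Fin n) → Minkowski n}
    (hf : ContDiffOn ℝ ∞ f S') {τ : EuclideanSpace ℝ (Fin n) → EuclideanSpace ℝ (Fin n)}
    (hτ : ContDiffOn ℝ ∞ τ S) (hm : MapsTo τ S S') {z : EuclideanSpace ℝ (Fin n)} (hz : z ∈ S)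
    {q : Minkowski n} (hq : ∀ w, minkowski (pd S' w f (τ z)) q = 0)
    (hpos : ∀ v : EuclideanSpace ℝ (Fin n), v ≠ 0 →
      0 < minkowski (pd S v (f ∘ τ) z) (pd S v (f ∘ τ) z))
    (A : EuclideanSpace ℝ (Fin n) →ₗ[ℝ] EuclideanSpace ℝ (Fin n))
    (hA : ∀ v w, minkowski (pd S' (A v) f (τ z)) (pd S' w f (τ z)) =
      minkowski (pd S' v (pd S' w f) (τ z)) q) :
    ((gram S (f ∘ τ) z)⁻¹ * shapeMatrix S (f ∘ τ) q z).trace = LinearMap.trace ℝ _ A ∧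
    ((gram S (f ∘ τ) z)⁻¹ * shapeMatrix S (f ∘ τ) q z *
      ((gram S (f ∘ τ) z)⁻¹ * shapeMatrix S (f ∘ τ) q z)).trace =
      LinearMap.trace ℝ _ (A ∘ₗ A) := by
  have hp : ContDiffOn ℝ ∞ (f ∘ τ) S := hf.comp hτ hm
  have h1 : ∀ v, pd S v (f ∘ τ) z = pd S' (fderivWithin ℝ τ S z v) f (τ z) := by
    intro v
    have d := ((hf (τ z) (hm hz)).differentiableWithinAt (by simp)).hasFDerivWithinAt
    have d' := ((hτ z hz).differentiableWithinAt (by simp)).hasFDerivWithinAt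
    rw [pd, (d.comp z d' hm).fderivWithin (hS.uniqueDiffOn z hz)]
    rfl
  have hinj : Function.Injective (fderivWithin ℝ τ S z).toLinearMap := by
    rw [← LinearMap.ker_eq_bot, LinearMap.ker_eq_bot']
    intro v hv
    by_contra hne
    have h2 := hpos v hne
    rw [h1, show fderivWithin ℝ τ S z v = 0 from hv] at h2
    simp [pd] at h2
  let D := LinearEquiv.ofInjectiveEndo _ hinj
  have hD : ∀ v, D v = fderivWithin ℝ τ S z v := fun v ↦ rfl
  set B : EuclideanSpace ℝ (Fin n) →ₗ[ℝ] EuclideanSpace ℝ (Fin n) := D.symm.conj A with hB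
  have hBA : ∀ v, fderivWithin ℝ τ S z (B v) = A (fderivWithin ℝ τ S z v) := by
    intro v
    rw [← hD, ← hD, hB]
    simp [LinearEquiv.conj_apply]
  set b := (EuclideanSpace.basisFun (Fin n) ℝ).toBasis with hb
  have hbv : ∀ i, b i = stdVec i := fun i ↦ by simp [hb, stdVec]
  set m := LinearMap.toMatrix b b B with hmdef
  have hG : gram S (f ∘ τ) z * m = shapeMatrix S (f ∘ τ) q z := by
    ext i j
    have e1 : pd S (B (stdVec j)) (f ∘ τ) z = ∑ l, m l j • pd S (stdVec l) (f ∘ τ) z := by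
      rw [pd, fderivWithin_apply_eq_sum]
      refine Finset.sum_congr rfl fun l _ ↦ ?_
      rw [hmdef, LinearMap.toMatrix_apply, hbv]
      simp [hb]
    have e2 : minkowski (pd S (B (stdVec j)) (f ∘ τ) z) (pd S (stdVec i) (f ∘ τ) z) =
        minkowski (pd S (stdVec j) (pd S (stdVec i) (f ∘ τ)) z) q := by
      rw [h1, h1, hBA, hA, minkowski_pd_pd_comp hS hS' hf hτ hm hz hq]
      rfl
    rw [shapeMatrix_symm hS hp hz, shapeMatrix, Matrix.of_apply, ← e2, e1, minkowski_sum_left,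
      Matrix.mul_apply]
    refine Finset.sum_congr rfl fun l _ ↦ ?_
    rw [minkowski_smul_left, gram_symm, mul_comm]
    rfl
  have hu : IsUnit (gram S (f ∘ τ) z).det := (posDef_gram hpos).det_pos.ne'.isUnit
  have hm' : (gram S (f ∘ τ) z)⁻¹ * shapeMatrix S (f ∘ τ) q z = m := by
    rw [← hG, ← Matrix.mul_assoc, Matrix.nonsing_inv_mul _ hu, Matrix.one_mul]
  rw [hm', hmdef, ← LinearMap.toMatrix_mul, ← LinearMap.trace_eq_matrix_trace,
    ← LinearMap.trace_eq_matrix_trace, hB]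
  refine ⟨LinearMap.trace_conj' A D.symm, ?_⟩
  rw [Module.End.mul_eq_comp, ← LinearEquiv.conj_comp]
  exact LinearMap.trace_conj' (A ∘ₗ A) D.symm

end ChartChange

section Charts

variable {n : ℕ} [NeZero n]
  {M : Type*} [TopologicalSpace M] [ChartedSpace (EuclideanHalfSpace n) M]

lemma isRegularDomain_target (c : M) : IsRegularDomain (extChartAt (𝓡∂ n) c).target :=
  ⟨uniqueDiffOn_extChartAt_target c, extChartAt_target_subset_closure_interior⟩

lemma fderivWithin_range_eq {X : Type*} [NormedAddCommGroup X] [NormedSpace ℝ X] {c : M}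
    {y : EuclideanSpace ℝ (Fin n)} (hy : y ∈ (extChartAt (𝓡∂ n) c).target)
    (u : EuclideanSpace ℝ (Fin n) → X) :
    fderivWithin ℝ u (range (𝓡∂ n)) y = fderivWithin ℝ u (extChartAt (𝓡∂ n) c).target y :=
  (fderivWithin_congr_set (extChartAt_target_eventuallyEq_of_mem hy)).symm

variable [IsManifold (𝓡∂ n) ∞ M]

lemma contDiffOn_comp_extChartAt_symm {X : Type*} [NormedAddCommGroup X] [NormedSpace ℝ X]
    {f : M → X} (hf : ContMDiff (𝓡∂ n) 𝓘(ℝ, X) ∞ f) (c : M) :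
    ContDiffOn ℝ ∞ (f ∘ (extChartAt (𝓡∂ n) c).symm) (extChartAt (𝓡∂ n) c).target :=
  contMDiffOn_iff_contDiffOn.1 (hf.comp_contMDiffOn (contMDiffOn_extChartAt_symm c))

/-- The derivative of `f` in the direction of a coordinate vector is the partial derivative of the
expression of `f` in the chart. -/
lemma mfderiv_mfderivWithin_symm {X : Type*} [NormedAddCommGroup X] [NormedSpace ℝ X]
    {f : M → X} (hf : ContMDiff (𝓡∂ n) 𝓘(ℝ, X) ∞ f) {c : M}
    {y : EuclideanSpace ℝ (Fin n)} (hy : y ∈ (extChartAt (𝓡∂ n) c).target)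
    (v : EuclideanSpace ℝ (Fin n)) :
    mfderiv (𝓡∂ n) 𝓘(ℝ, X) f ((extChartAt (𝓡∂ n) c).symm y)
      (mfderivWithin 𝓘(ℝ, EuclideanSpace ℝ (Fin n)) (𝓡∂ n) (extChartAt (𝓡∂ n) c).symm
        (range (𝓡∂ n)) y v) =
      pd (extChartAt (𝓡∂ n) c).target v (f ∘ (extChartAt (𝓡∂ n) c).symm) y := by
  have : IsManifold (𝓡∂ n) 1 M := .of_le (n := ∞) (by simp)
  have h1 := (hf ((extChartAt (𝓡∂ n) c).symm y)).mdifferentiableAt (by simp)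
  have h2 := mdifferentiableWithinAt_extChartAt_symm (I := 𝓡∂ n) hy
  have hu : UniqueMDiffWithinAt 𝓘(ℝ, EuclideanSpace ℝ (Fin n)) (range (𝓡∂ n)) y :=
    uniqueMDiffWithinAt_iff_uniqueDiffWithinAt.2
      ((𝓡∂ n).uniqueDiffOn y (extChartAt_target_subset_range c hy))
  have h3 := mfderiv_comp_mfderivWithin y h1 h2 hu
  rw [mfderivWithin_eq_fderivWithin] at h3
  rw [pd, ← fderivWithin_range_eq hy]
  exact (congrArg (fun l ↦ l v) h3).symm

lemma coordMatrix_inducedForm {f : M → Minkowski n}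
    (hf : ContMDiff (𝓡∂ n) 𝓘(ℝ, Minkowski n) ∞ f) {c : M}
    {y : EuclideanSpace ℝ (Fin n)} (hy : y ∈ (extChartAt (𝓡∂ n) c).target) :
    coordMatrix (inducedForm f) c y =
      gram (extChartAt (𝓡∂ n) c).target (f ∘ (extChartAt (𝓡∂ n) c).symm) y := by
  ext i j
  simp only [coordMatrix, inducedForm, gram, Matrix.of_apply, coordVec]
  rw [mfderiv_mfderivWithin_symm hf hy, mfderiv_mfderivWithin_symm hf hy]

/-- A map inducing a positive definite form does so in each chart. -/
lemma minkowski_pd_pos {f : M → Minkowski n}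
    (hf : ContMDiff (𝓡∂ n) 𝓘(ℝ, Minkowski n) ∞ f)
    (hpos : ∀ (x : M) (v : TangentSpace (𝓡∂ n) x), v ≠ 0 → 0 < inducedForm f x v v) {c : M}
    {y : EuclideanSpace ℝ (Fin n)} (hy : y ∈ (extChartAt (𝓡∂ n) c).target)
    {v : EuclideanSpace ℝ (Fin n)} (hv : v ≠ 0) :
    0 < minkowski (pd (extChartAt (𝓡∂ n) c).target v (f ∘ (extChartAt (𝓡∂ n) c).symm) y)
      (pd (extChartAt (𝓡∂ n) c).target v (f ∘ (extChartAt (𝓡∂ n) c).symm) y) := by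
  have : IsManifold (𝓡∂ n) 1 M := .of_le (n := ∞) (by simp)
  rw [← mfderiv_mfderivWithin_symm hf hy]
  refine hpos _ _ fun h ↦ hv ?_
  have hinj := (isInvertible_mfderivWithin_extChartAt_symm (I := 𝓡∂ n) hy).injective
  exact hinj (h.trans (map_zero _).symm)

end Charts

/-! ### The shape operator in charts -/

section Shape

variable {n : ℕ} [NeZero n]
  {M : Type*} [TopologicalSpace M] [ChartedSpace (EuclideanHalfSpace n) M]

/-- In the chart centred at `x`, the coordinates of a tangent vector at `x` are the vector itself. -/
lemma mfderiv_eq_pd {f : M → Minkowski n} (hf : ContMDiff (𝓡∂ n) 𝓘(ℝ, Minkowski n) ∞ f) (x : M)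
    (v : EuclideanSpace ℝ (Fin n)) :
    (mfderiv (𝓡∂ n) 𝓘(ℝ, Minkowski n) f x : EuclideanSpace ℝ (Fin n) → Minkowski n) v =
      pd (extChartAt (𝓡∂ n) x).target v (f ∘ (extChartAt (𝓡∂ n) x).symm)
        (extChartAt (𝓡∂ n) x x) := by
  let L : EuclideanSpace ℝ (Fin n) →L[ℝ] Minkowski n := mfderiv (𝓡∂ n) 𝓘(ℝ, Minkowski n) f x
  have h1 : HasFDerivWithinAt (f ∘ (extChartAt (𝓡∂ n) x).symm) L (range (𝓡∂ n))
      (extChartAt (𝓡∂ n) x x) := ((hf x).mdifferentiableAt (by simp)).hasMFDerivAt.2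
  have h := (h1.fderivWithin ((𝓡∂ n).uniqueDiffOn _ (mem_range_self _))).symm
  rw [pd, ← fderivWithin_range_eq (mem_extChartAt_target x)]
  exact congrArg (fun l ↦ l v) h

/-- A smooth map into the light-cone whose induced form is positive definite. -/
structure IsSpacelikeImmersion (p : M → Minkowski n) : Prop where
  smooth : ContMDiff (𝓡∂ n) 𝓘(ℝ, Minkowski n) ∞ p
  mem_lightCone : ∀ x, p x ∈ lightCone n
  pos : ∀ (x : M) (v : TangentSpace (𝓡∂ n) x), v ≠ 0 → 0 < inducedForm p x v v

variable [IsManifold (𝓡∂ n) ∞ M] {p : M → Minkowski n}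

/-- The image of a spacelike immersion avoids the vertex of the light-cone, because there
`⟨∂ᵢ∂ᵢp, p⟩ = -⟨∂ᵢp, ∂ᵢp⟩` would fail. -/
lemma IsSpacelikeImmersion.exists_isNullFrame (hp : IsSpacelikeImmersion p) {c : M}
    {y : EuclideanSpace ℝ (Fin n)} (hy : y ∈ (extChartAt (𝓡∂ n) c).target) :
    ∃ q, IsNullFrame (fderivWithin ℝ (p ∘ (extChartAt (𝓡∂ n) c).symm)
      (extChartAt (𝓡∂ n) c).target y).toLinearMap (p ((extChartAt (𝓡∂ n) c).symm y)) q := by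
  have hT := isRegularDomain_target (n := n) c
  have hs := contDiffOn_comp_extChartAt_symm hp.smooth c
  have hpp : ∀ z ∈ (extChartAt (𝓡∂ n) c).target,
      minkowski ((p ∘ (extChartAt (𝓡∂ n) c).symm) z) ((p ∘ (extChartAt (𝓡∂ n) c).symm) z) = 0 :=
    fun z _ ↦ hp.mem_lightCone ((extChartAt (𝓡∂ n) c).symm z)
  refine LightCone.exists_isNullFrame _ (fun v hv ↦ minkowski_pd_pos hp.smooth hp.pos hy hv)
    (hp.mem_lightCone _) (fun h0 ↦ ?_) fun v ↦ minkowski_pd_self hT hs hpp hy v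
  have hv : (stdVec 0 : EuclideanSpace ℝ (Fin n)) ≠ 0 := by simp [stdVec]
  have h1 := minkowski_pd_pos hp.smooth hp.pos hy hv
  have h2 := minkowski_pd_pd_self hT hs hpp hy (stdVec 0) (stdVec 0)
  rw [Function.comp_apply, h0, minkowski_zero_right] at h2
  linarith

/-- The dual map, defined by choice, has its defining properties; they are stated here in terms of
the expression of `p` in a chart. -/
lemma IsSpacelikeImmersion.isNullFrame_dualMap (hp : IsSpacelikeImmersion p) {c : M}
    {y : EuclideanSpace ℝ (Fin n)} (hy : y ∈ (extChartAt (𝓡∂ n) c).target) :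
    IsNullFrame (fderivWithin ℝ (p ∘ (extChartAt (𝓡∂ n) c).symm)
      (extChartAt (𝓡∂ n) c).target y).toLinearMap (p ((extChartAt (𝓡∂ n) c).symm y))
      (dualMap p ((extChartAt (𝓡∂ n) c).symm y)) := by
  have : IsManifold (𝓡∂ n) 1 M := .of_le (n := ∞) (by simp)
  obtain ⟨q, hq⟩ := hp.exists_isNullFrame hy
  have hspec := Classical.epsilon_spec (p := fun q : Minkowski n ↦ q ∈ lightCone n ∧
    minkowski (p ((extChartAt (𝓡∂ n) c).symm y)) q = 1 ∧
    ∀ v : TangentSpace (𝓡∂ n) ((extChartAt (𝓡∂ n) c).symm y), minkowski (n := n)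
      (mfderiv (𝓡∂ n) 𝓘(ℝ, Minkowski n) p ((extChartAt (𝓡∂ n) c).symm y) v) q = 0)
    ⟨q, hq.qq, hq.pq, fun v ↦ by
      obtain ⟨w, rfl⟩ :=
        (isInvertible_mfderivWithin_extChartAt_symm (I := 𝓡∂ n) hy).bijective.surjective v
      erw [mfderiv_mfderivWithin_symm hp.smooth hy w]
      exact hq.Lq w⟩
  exact ⟨hq.pos, hq.pp, hspec.1, hspec.2.1, hq.Lp, fun v ↦ by
    have h := hspec.2.2 (mfderivWithin 𝓘(ℝ, EuclideanSpace ℝ (Fin n)) (𝓡∂ n)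
      (extChartAt (𝓡∂ n) c).symm (range (𝓡∂ n)) y v)
    erw [mfderiv_mfderivWithin_symm hp.smooth hy v] at h
    exact h⟩

lemma IsSpacelikeImmersion.minkowski_secondFundamentalForm (hp : IsSpacelikeImmersion p) (x : M)
    (v w : EuclideanSpace ℝ (Fin n)) :
    minkowski (secondFundamentalForm p x v w) (dualMap p x) =
      minkowski (pd (extChartAt (𝓡∂ n) x).target v (pd (extChartAt (𝓡∂ n) x).target w
        (p ∘ (extChartAt (𝓡∂ n) x).symm)) (extChartAt (𝓡∂ n) x x)) (dualMap p x) := by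
  have hy := mem_extChartAt_target (I := 𝓡∂ n) x
  have hq := hp.isNullFrame_dualMap hy
  rw [extChartAt_to_inv] at hq
  have hproj : ∀ u, minkowski (normalProj p x u) (dualMap p x) = minkowski u (dualMap p x) := by
    intro u
    rw [normalProj, minkowski_add_left, minkowski_smul_left, minkowski_smul_left, hq.pq, hq.qq,
      mul_one, mul_zero, add_zero]
  refine (hproj _).trans ?_
  rw [pd_pd (isRegularDomain_target x) (contDiffOn_comp_extChartAt_symm hp.smooth x) hy,
    fderivWithin_range_eq hy,
    fderivWithin_congr (fun z hz ↦ fderivWithin_range_eq hz _) (fderivWithin_range_eq hy _)]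

/-- The shape operator, defined by choice, has its defining property. -/
lemma IsSpacelikeImmersion.shapeOperator_spec (hp : IsSpacelikeImmersion p) (x : M) :
    ∀ v w : TangentSpace (𝓡∂ n) x, inducedForm p x (shapeOperator p x v) w =
      minkowski (secondFundamentalForm p x v w) (dualMap p x) := by
  refine Classical.epsilon_spec (p := fun A : TangentSpace (𝓡∂ n) x →ₗ[ℝ] TangentSpace (𝓡∂ n) x ↦
    ∀ v w : TangentSpace (𝓡∂ n) x,
      inducedForm p x (A v) w = minkowski (secondFundamentalForm p x v w) (dualMap p x)) ?_
  have hS : ∀ v w : TangentSpace (𝓡∂ n) x,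
      minkowski (secondFundamentalForm p x v w) (dualMap p x) =
      minkowski (fderivWithin ℝ (fun y ↦ fderivWithin ℝ (p ∘ (extChartAt (𝓡∂ n) x).symm)
        (extChartAt (𝓡∂ n) x).target y) (extChartAt (𝓡∂ n) x).target (extChartAt (𝓡∂ n) x x)
        (v : EuclideanSpace ℝ (Fin n)) (w : EuclideanSpace ℝ (Fin n))) (dualMap p x) := by
    intro v w
    refine (hp.minkowski_secondFundamentalForm x v w).trans ?_
    exact congrArg (fun u ↦ minkowski u _) (pd_pd (isRegularDomain_target x)
      (contDiffOn_comp_extChartAt_symm hp.smooth x) (mem_extChartAt_target x))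
  obtain ⟨A, hA⟩ := exists_endomorphism
    (E := EuclideanSpace ℝ (Fin n)) (fderivWithin ℝ (p ∘ (extChartAt (𝓡∂ n) x).symm)
      (extChartAt (𝓡∂ n) x).target (extChartAt (𝓡∂ n) x x)).toLinearMap
    (fun v hv ↦ minkowski_pd_pos hp.smooth hp.pos (mem_extChartAt_target x) hv)
    (LinearMap.mk₂ ℝ (fun v w ↦ minkowski (fderivWithin ℝ (fun y ↦ fderivWithin ℝ
      (p ∘ (extChartAt (𝓡∂ n) x).symm) (extChartAt (𝓡∂ n) x).target y)
      (extChartAt (𝓡∂ n) x).target (extChartAt (𝓡∂ n) x x) v w) (dualMap p x))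
      (by simp [minkowski_add_left]) (by simp [minkowski_smul_left])
      (by simp [minkowski_add_left]) (by simp [minkowski_smul_left]))
  refine ⟨A, fun v w ↦ ?_⟩
  rw [hS]
  refine Eq.trans ?_ (hA v w)
  exact congrArg₂ minkowski (mfderiv_eq_pd hp.smooth x _) (mfderiv_eq_pd hp.smooth x _)

/-- The traces of `A` and `A²`, computed in any chart. -/
lemma IsSpacelikeImmersion.trace_shapeMatrix (hp : IsSpacelikeImmersion p) {c : M}
    {y : EuclideanSpace ℝ (Fin n)} (hy : y ∈ (extChartAt (𝓡∂ n) c).target) {G a :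
      Matrix (Fin n) (Fin n) ℝ}
    (hG : G = gram (extChartAt (𝓡∂ n) c).target (p ∘ (extChartAt (𝓡∂ n) c).symm) y)
    (ha : a = shapeMatrix (extChartAt (𝓡∂ n) c).target (p ∘ (extChartAt (𝓡∂ n) c).symm)
      (dualMap p ((extChartAt (𝓡∂ n) c).symm y)) y) :
    (G⁻¹ * a).trace = LinearMap.trace ℝ (TangentSpace (𝓡∂ n) ((extChartAt (𝓡∂ n) c).symm y))
      (shapeOperator p ((extChartAt (𝓡∂ n) c).symm y)) ∧
    (G⁻¹ * a * (G⁻¹ * a)).trace =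
      LinearMap.trace ℝ (TangentSpace (𝓡∂ n) ((extChartAt (𝓡∂ n) c).symm y))
      (shapeOperator p ((extChartAt (𝓡∂ n) c).symm y) ∘ₗ
        shapeOperator p ((extChartAt (𝓡∂ n) c).symm y)) := by
  set x := (extChartAt (𝓡∂ n) c).symm y with hx
  set T := (extChartAt (𝓡∂ n) c).target with hTdef
  set T' := (extChartAt (𝓡∂ n) x).target with hT'def
  have hT : IsRegularDomain T := isRegularDomain_target c
  set τ := extChartAt (𝓡∂ n) x ∘ (extChartAt (𝓡∂ n) c).symm with hτdef
  -- the part of the chart at `c` on which the change of coordinates `τ` is defined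
  obtain ⟨U, hU, hUeq⟩ := (continuousOn_iff'.1 (continuousOn_extChartAt_symm (I := 𝓡∂ n) c))
    _ (isOpen_extChartAt_source (I := 𝓡∂ n) x)
  have hmem : ∀ z ∈ T ∩ U, (extChartAt (𝓡∂ n) c).symm z ∈ (extChartAt (𝓡∂ n) x).source := by
    intro z hz
    have : z ∈ (extChartAt (𝓡∂ n) c).symm ⁻¹' (extChartAt (𝓡∂ n) x).source ∩
        (extChartAt (𝓡∂ n) c).target := by rw [hUeq]; exact ⟨hz.2, hz.1⟩
    exact this.1
  have hyU : y ∈ U := by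
    have : y ∈ U ∩ (extChartAt (𝓡∂ n) c).target := by
      rw [← hUeq]
      exact ⟨mem_extChartAt_source x, hy⟩
    exact this.1
  have hyS : y ∈ T ∩ U := ⟨hy, hyU⟩
  have hτ : ContDiffOn ℝ ∞ τ (T ∩ U) := by
    refine contMDiffOn_iff_contDiffOn.1 ?_
    exact (contMDiffOn_extChartAt (I := 𝓡∂ n) (n := ∞) (x := x)).comp
      ((contMDiffOn_extChartAt_symm c).mono inter_subset_left) (fun z hz ↦ by
        have := hmem z hz
        rwa [extChartAt_source] at this)
  have hm : MapsTo τ (T ∩ U) T' := fun z hz ↦ (extChartAt (𝓡∂ n) x).map_source (hmem z hz)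
  have hcomp : ∀ z ∈ T ∩ U, (p ∘ (extChartAt (𝓡∂ n) c).symm) z =
      ((p ∘ (extChartAt (𝓡∂ n) x).symm) ∘ τ) z := fun z hz ↦ by
    simp only [Function.comp_apply, hτdef, (extChartAt (𝓡∂ n) x).left_inv (hmem z hz)]
  have hpd : ∀ v, ∀ z ∈ T ∩ U, pd T v (p ∘ (extChartAt (𝓡∂ n) c).symm) z =
      pd (T ∩ U) v ((p ∘ (extChartAt (𝓡∂ n) x).symm) ∘ τ) z := fun v z hz ↦ by
    rw [← pd_inter hU hz.2, pd_congr hcomp hz]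
  have hG' : G = gram (T ∩ U) ((p ∘ (extChartAt (𝓡∂ n) x).symm) ∘ τ) y := by
    rw [hG]
    ext i j
    simp only [gram, Matrix.of_apply, hpd _ y hyS]
  have ha' : a = shapeMatrix (T ∩ U) ((p ∘ (extChartAt (𝓡∂ n) x).symm) ∘ τ) (dualMap p x) y := by
    rw [ha]
    ext i j
    simp only [shapeMatrix, Matrix.of_apply]
    rw [← pd_inter hU hyU, pd_congr (hpd _) hyS]
  have hτy : τ y = extChartAt (𝓡∂ n) x x := rfl
  rw [hG', ha']
  refine trace_shapeMatrix_comp (hT.inter hU) (isRegularDomain_target x)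
    (contDiffOn_comp_extChartAt_symm hp.smooth x) hτ hm hyS ?_ ?_ _ ?_
  · intro w
    have := (hp.isNullFrame_dualMap (mem_extChartAt_target (I := 𝓡∂ n) x)).Lq w
    rw [extChartAt_to_inv] at this
    exact this
  · intro v hv
    rw [← hpd v y hyS]
    exact minkowski_pd_pos hp.smooth hp.pos hy hv
  · intro v w
    rw [hτy, ← hp.minkowski_secondFundamentalForm x v w, ← hp.shapeOperator_spec x v w]
    exact congrArg₂ minkowski (mfderiv_eq_pd hp.smooth x _).symm (mfderiv_eq_pd hp.smooth x _).symm

end Shape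

/-! ### Vanishing scalar curvature -/

section ScalarCurvature

variable {n : ℕ} [NeZero n]
  {M : Type*} [TopologicalSpace M] [ChartedSpace (EuclideanHalfSpace n) M]

lemma coordDeriv_eq_pd {c : M} {y : EuclideanSpace ℝ (Fin n)}
    (hy : y ∈ (extChartAt (𝓡∂ n) c).target) (k : Fin n) {u u' : EuclideanSpace ℝ (Fin n) → ℝ}
    (h : ∀ z ∈ (extChartAt (𝓡∂ n) c).target, u z = u' z) :
    coordDeriv k u y = pd (extChartAt (𝓡∂ n) c).target (stdVec k) u' y := by
  rw [coordDeriv, fderivWithin_range_eq hy, ← pd, pd_congr h hy]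

variable [IsManifold (𝓡∂ n) ∞ M] {p : M → Minkowski n}

lemma curvatureTensor_inducedForm (hp : ContMDiff (𝓡∂ n) 𝓘(ℝ, Minkowski n) ∞ p) {c : M}
    {y : EuclideanSpace ℝ (Fin n)} (hy : y ∈ (extChartAt (𝓡∂ n) c).target) (l k i j : Fin n) :
    curvatureTensor (inducedForm p) c l k i j y = localCurvature (extChartAt (𝓡∂ n) c).target
      (gram (extChartAt (𝓡∂ n) c).target (p ∘ (extChartAt (𝓡∂ n) c).symm)) l k i j y := by
  have hG : ∀ i j, ∀ z ∈ (extChartAt (𝓡∂ n) c).target, coordMatrix (inducedForm p) c z i j =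
      gram (extChartAt (𝓡∂ n) c).target (p ∘ (extChartAt (𝓡∂ n) c).symm) z i j :=
    fun i j z hz ↦ by rw [coordMatrix_inducedForm hp hz]
  have hΓ : ∀ k i j, ∀ z ∈ (extChartAt (𝓡∂ n) c).target, christoffel (inducedForm p) c k i j z =
      localChristoffel (extChartAt (𝓡∂ n) c).target
        (gram (extChartAt (𝓡∂ n) c).target (p ∘ (extChartAt (𝓡∂ n) c).symm)) k i j z := by
    intro k i j z hz
    rw [christoffel, localChristoffel, coordMatrix_inducedForm hp hz]
    congr 1
    refine Finset.sum_congr rfl fun l _ ↦ ?_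
    rw [coordDeriv_eq_pd hz i (hG j l), coordDeriv_eq_pd hz j (hG i l),
      coordDeriv_eq_pd hz l (hG i j)]
  rw [curvatureTensor, localCurvature, coordDeriv_eq_pd hy i (hΓ l j k),
    coordDeriv_eq_pd hy j (hΓ l i k)]
  simp only [hΓ _ _ _ y hy]

/-- For a hypersurface of the light-cone, vanishing scalar curvature means that the shape operator
has trace zero. -/
lemma IsSpacelikeImmersion.trace_shapeOperator_eq_zero (hn : 2 ≤ n) (hp : IsSpacelikeImmersion p)
    {x : M} (hS : scalarCurvature (inducedForm p) x = 0) :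
    LinearMap.trace ℝ (TangentSpace (𝓡∂ n) x) (shapeOperator p x) = 0 := by
  have hy := mem_extChartAt_target (I := 𝓡∂ n) x
  have h0 : ∀ y ∈ (extChartAt (𝓡∂ n) x).target,
      (gram (extChartAt (𝓡∂ n) x).target (p ∘ (extChartAt (𝓡∂ n) x).symm) y).det ≠ 0 :=
    fun y hy ↦ (posDef_gram fun v hv ↦ minkowski_pd_pos hp.smooth hp.pos hy hv).det_pos.ne'
  have h := scalar_curvature_eq (isRegularDomain_target x)
    (contDiffOn_comp_extChartAt_symm hp.smooth x) (fun y _ ↦ hp.mem_lightCone _) h0 hy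
    (hp.isNullFrame_dualMap hy)
  simp only [scalarCurvature, coordMatrix_inducedForm hp.smooth hy,
    curvatureTensor_inducedForm hp.smooth hy] at hS
  rw [hS, (hp.trace_shapeMatrix hy rfl rfl).1] at h
  have hn' : (2 : ℝ) ≤ n := by exact_mod_cast hn
  have h1 := (mul_eq_zero.1 h.symm).resolve_left (by
    have : (0 : ℝ) < n - 1 := by linarith
    simp [this.ne'])
  rwa [extChartAt_to_inv] at h1

end ScalarCurvature

/-! ### Integration over the charts -/

section Volume

variable {n : ℕ} [NeZero n]
  {M : Type*} [TopologicalSpace M] [ChartedSpace (EuclideanHalfSpace n) M]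

lemma measurableSet_target (c : M) : MeasurableSet (extChartAt (𝓡∂ n) c).target := by
  rw [extChartAt_target]
  exact (((chartAt (EuclideanHalfSpace n) c).open_target.preimage
    (𝓡∂ n).continuous_symm).measurableSet).inter (𝓡∂ n).isClosed_range.measurableSet

variable [IsManifold (𝓡∂ n) ∞ M] [CompactSpace M] [T2Space M]

/-- The image in the chart at `c` of the support of the corresponding function of the partition of
unity. -/
def chartCompact (c : M) : Set (EuclideanSpace ℝ (Fin n)) :=
  extChartAt (𝓡∂ n) c '' tsupport (chartPartition n M c)

/-- The function of the partition of unity for the chart at `c`, in coordinates. -/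
noncomputable def chartWeight (c : M) (y : EuclideanSpace ℝ (Fin n)) : ℝ :=
  chartPartition n M c ((extChartAt (𝓡∂ n) c).symm y)

lemma tsupport_chartPartition_subset (c : M) :
    tsupport (chartPartition n M c) ⊆ (extChartAt (𝓡∂ n) c).source := by
  rw [extChartAt_source]
  exact Classical.choose_spec
    (SmoothPartitionOfUnity.exists_isSubordinate_chartAt_source (𝓡∂ n) M) c

lemma isCompact_chartCompact (c : M) : IsCompact (chartCompact (n := n) c) :=
  (isClosed_tsupport _).isCompact.image_of_continuousOn
    ((continuousOn_extChartAt c).mono (tsupport_chartPartition_subset c))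

lemma chartCompact_subset_target (c : M) :
    chartCompact (n := n) c ⊆ (extChartAt (𝓡∂ n) c).target := by
  rintro _ ⟨x, hx, rfl⟩
  exact (extChartAt (𝓡∂ n) c).map_source (tsupport_chartPartition_subset c hx)

lemma chartWeight_eq_zero {c : M} {y : EuclideanSpace ℝ (Fin n)}
    (hy : y ∈ (extChartAt (𝓡∂ n) c).target) (hyK : y ∉ chartCompact c) : chartWeight c y = 0 := by
  by_contra h
  exact hyK ⟨_, subset_tsupport _ h, (extChartAt (𝓡∂ n) c).right_inv hy⟩

lemma continuousOn_chartWeight (c : M) :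
    ContinuousOn (chartWeight (n := n) c) (extChartAt (𝓡∂ n) c).target :=
  (chartPartition n M c).contMDiff.continuous.comp_continuousOn (continuousOn_extChartAt_symm c)

lemma finite_chartPartition :
    {c : M | (Function.support (chartPartition n M c)).Nonempty}.Finite :=
  (chartPartition n M).locallyFinite.finite_nonempty_of_compact

variable (n M) in
/-- The charts that contribute to the Riemannian volume. -/
noncomputable def activeCharts : Finset M := (finite_chartPartition (n := n) (M := M)).toFinset

variable [MeasurableSpace M]

lemma volumeMeasure_eq_sum (h : TangentForm n M) :
    volumeMeasure h = ∑ c ∈ activeCharts n M, (chartVolume h c).withDensity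
      fun x ↦ ENNReal.ofReal (chartPartition n M c x) := by
  ext s hs
  rw [volumeMeasure, Measure.sum_apply _ hs, Measure.finsetSum_apply]
  refine tsum_eq_sum fun c hc ↦ ?_
  have h0 : ∀ x, chartPartition n M c x = 0 := by
    intro x
    by_contra hx
    exact hc (finite_chartPartition.mem_toFinset.2 ⟨x, hx⟩)
  simp [h0]

variable [BorelSpace M]

/-- Integration of a continuous function against one term of the Riemannian volume. -/
lemma integral_chartVolume {h : TangentForm n M} {c : M}
    (hh : ContinuousOn (fun y ↦ (coordMatrix h c y).det) (extChartAt (𝓡∂ n) c).target)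
    {u : M → ℝ} (hu : Continuous u) :
    Integrable u ((chartVolume h c).withDensity
      fun x ↦ ENNReal.ofReal (chartPartition n M c x)) ∧
    ∫ x, u x ∂((chartVolume h c).withDensity fun x ↦ ENNReal.ofReal (chartPartition n M c x)) =
      ∫ y in chartCompact c, chartWeight c y *
        (√(coordMatrix h c y).det * u ((extChartAt (𝓡∂ n) c).symm y)) := by
  set T := (extChartAt (𝓡∂ n) c).target with hTdef
  have hTm : MeasurableSet T := measurableSet_target c
  have hsymm := continuousOn_extChartAt_symm (I := 𝓡∂ n) c
  set ν : Measure (EuclideanSpace ℝ (Fin n)) := (volume.restrict T).withDensity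
    fun y ↦ ENNReal.ofReal (√(coordMatrix h c y).det) with hν
  have hd : AEMeasurable (fun y ↦ ENNReal.ofReal (√(coordMatrix h c y).det))
      (volume.restrict T) :=
    (hh.sqrt.aemeasurable hTm).ennreal_ofReal
  have hs : AEMeasurable (extChartAt (𝓡∂ n) c).symm ν :=
    (hsymm.aemeasurable hTm).mono_ac (withDensity_absolutelyContinuous _ _)
  have hρ : Continuous (chartPartition n M c) := (chartPartition n M c).contMDiff.continuous
  have hρm : AEMeasurable (fun x ↦ ENNReal.ofReal (chartPartition n M c x))
      (ν.map (extChartAt (𝓡∂ n) c).symm) := hρ.measurable.ennreal_ofReal.aemeasurable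
  have hcv : chartVolume h c = ν.map (extChartAt (𝓡∂ n) c).symm := rfl
  have hρu : AEStronglyMeasurable (fun x ↦ chartPartition n M c x * u x)
      (ν.map (extChartAt (𝓡∂ n) c).symm) := (hρ.mul hu).aestronglyMeasurable
  have hcont : ContinuousOn (fun y ↦ chartWeight c y *
      (√(coordMatrix h c y).det * u ((extChartAt (𝓡∂ n) c).symm y))) T :=
    (continuousOn_chartWeight c).mul (hh.sqrt.mul (hu.comp_continuousOn hsymm))
  have hzero : ∀ y ∈ T \ chartCompact c, chartWeight c y *
      (√(coordMatrix h c y).det * u ((extChartAt (𝓡∂ n) c).symm y)) = 0 := fun y hy ↦ by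
    rw [chartWeight_eq_zero hy.1 hy.2, zero_mul]
  have hint : IntegrableOn (fun y ↦ chartWeight c y *
      (√(coordMatrix h c y).det * u ((extChartAt (𝓡∂ n) c).symm y))) T :=
    (((hcont.mono (chartCompact_subset_target c)).integrableOn_compact
      (isCompact_chartCompact c))).of_forall_sdiff_eq_zero hTm hzero
  have hfun : (fun y ↦ (ENNReal.ofReal (√(coordMatrix h c y).det)).toReal •
      (chartPartition n M c ((extChartAt (𝓡∂ n) c).symm y) *
        u ((extChartAt (𝓡∂ n) c).symm y))) =
      fun y ↦ chartWeight c y *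
        (√(coordMatrix h c y).det * u ((extChartAt (𝓡∂ n) c).symm y)) := by
    ext y
    rw [ENNReal.toReal_ofReal (Real.sqrt_nonneg _), smul_eq_mul, chartWeight]
    ring
  have hfun' : (fun x ↦ (ENNReal.ofReal (chartPartition n M c x)).toReal • u x) =
      fun x ↦ chartPartition n M c x * u x := by
    ext x
    rw [ENNReal.toReal_ofReal ((chartPartition n M).nonneg c x), smul_eq_mul]
  have hlt (f : M → ℝ) {μ : Measure M} : ∀ᵐ x ∂μ, ENNReal.ofReal (f x) < ⊤ :=
    ae_of_all _ fun _ ↦ ENNReal.ofReal_lt_top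
  have hlt' (f : EuclideanSpace ℝ (Fin n) → ℝ) {μ : Measure (EuclideanSpace ℝ (Fin n))} :
      ∀ᵐ y ∂μ, ENNReal.ofReal (f y) < ⊤ := ae_of_all _ fun _ ↦ ENNReal.ofReal_lt_top
  constructor
  · rw [hcv, integrable_withDensity_iff_integrable_smul₀' hρm (hlt _), hfun',
      integrable_map_measure hρu hs, hν, integrable_withDensity_iff_integrable_smul₀' hd (hlt' _)]
    exact hfun ▸ hint
  · rw [hcv, integral_withDensity_eq_integral_toReal_smul₀ hρm (hlt _), hfun',
      integral_map hs hρu, hν, integral_withDensity_eq_integral_toReal_smul₀ hd (hlt' _), hfun]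
    exact setIntegral_eq_of_subset_of_forall_sdiff_eq_zero hTm (chartCompact_subset_target c) hzero

/-- Integration of a continuous function against the Riemannian volume. -/
lemma integral_volumeMeasure {h : TangentForm n M}
    (hh : ∀ c, ContinuousOn (fun y ↦ (coordMatrix h c y).det) (extChartAt (𝓡∂ n) c).target)
    {u : M → ℝ} (hu : Continuous u) :
    Integrable u (volumeMeasure h) ∧
    ∫ x, u x ∂(volumeMeasure h) = ∑ c ∈ activeCharts n M, ∫ y in chartCompact c, chartWeight c y *
        (√(coordMatrix h c y).det * u ((extChartAt (𝓡∂ n) c).symm y)) := by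
  rw [volumeMeasure_eq_sum, integrable_finsetSum_measure,
    integral_finsetSum_measure fun c _ ↦ (integral_chartVolume (hh c) hu).1]
  exact ⟨fun c _ ↦ (integral_chartVolume (hh c) hu).1,
    Finset.sum_congr rfl fun c _ ↦ (integral_chartVolume (hh c) hu).2⟩

/-- The volume is finite and is computed in the charts. -/
lemma volumeMeasure_univ {h : TangentForm n M}
    (hh : ∀ c, ContinuousOn (fun y ↦ (coordMatrix h c y).det) (extChartAt (𝓡∂ n) c).target) :
    volumeMeasure h univ < ⊤ ∧ (volumeMeasure h).real univ =
      ∑ c ∈ activeCharts n M, ∫ y in chartCompact c, chartWeight c y *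
        √(coordMatrix h c y).det := by
  have h1 := integral_volumeMeasure hh (continuous_const (y := (1 : ℝ)))
  refine ⟨?_, ?_⟩
  · have := (integrable_const_iff.1 h1.1).resolve_left one_ne_zero
    exact this.measure_univ_lt_top
  · simpa using h1.2

end Volume

/-- Differentiation under the integral sign on a compact set. -/
lemma hasDerivAt_integral_slice {n : ℕ} {I : Set ℝ} (hI : IsOpen I)
    {T K : Set (EuclideanSpace ℝ (Fin n))} (hT : IsRegularDomain T) (hK : IsCompact K)
    (hKT : K ⊆ T) {w : EuclideanSpace ℝ (Fin n) → ℝ} (hw : ContinuousOn w K)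
    {k : ℝ × EuclideanSpace ℝ (Fin n) → ℝ} (hk : ContDiffOn ℝ ∞ k (I ×ˢ T)) {t : ℝ} (ht : t ∈ I) :
    HasDerivAt (fun t ↦ ∫ y in K, w y * k (t, y))
      (∫ y in K, w y * pd (I ×ˢ T) ((1 : ℝ), (0 : EuclideanSpace ℝ (Fin n))) k (t, y)) t := by
  have hk' := (contDiffOn_pd (hT.prod hI) hk ((1 : ℝ), (0 : EuclideanSpace ℝ (Fin n)))).continuousOn
  set k' := pd (I ×ˢ T) ((1 : ℝ), (0 : EuclideanSpace ℝ (Fin n))) k with hk'def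
  have hslice : ∀ {g : ℝ × EuclideanSpace ℝ (Fin n) → ℝ}, ContinuousOn g (I ×ˢ T) → ∀ s ∈ I,
      ContinuousOn (fun y ↦ w y * g (s, y)) K := fun hg s hs ↦
    hw.mul (hg.comp (by fun_prop) fun y hy ↦ ⟨hs, hKT hy⟩)
  obtain ⟨δ, hδ, hball⟩ := Metric.nhds_basis_closedBall.mem_iff.1 (hI.mem_nhds ht)
  have hcomp : IsCompact (Metric.closedBall t δ ×ˢ K) := (isCompact_closedBall t δ).prod hK
  have hg : ContinuousOn (fun z : ℝ × EuclideanSpace ℝ (Fin n) ↦ w z.2 * k' z)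
      (Metric.closedBall t δ ×ˢ K) :=
    (hw.comp continuousOn_snd fun z hz ↦ hz.2).mul (hk'.mono (prod_mono hball hKT))
  obtain ⟨C, hC⟩ := hcomp.exists_bound_of_continuousOn hg
  have hmem : ∀ᵐ y ∂(volume.restrict K), y ∈ K := ae_restrict_mem hK.measurableSet
  refine (hasDerivAt_integral_of_dominated_loc_of_deriv_le (bound := fun _ ↦ C)
    (F := fun t y ↦ w y * k (t, y)) (F' := fun t y ↦ w y * k' (t, y))
    (Metric.closedBall_mem_nhds t hδ) ?_ ?_ ?_ ?_ ?_ ?_).2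
  · filter_upwards [hI.mem_nhds ht] with s hs
    exact (hslice hk.continuousOn s hs).aestronglyMeasurable hK.measurableSet
  · exact (hslice hk.continuousOn t ht).integrableOn_compact hK
  · exact (hslice hk' t ht).aestronglyMeasurable hK.measurableSet
  · filter_upwards [hmem] with y hy s hs
    exact hC (s, y) ⟨hs, hy⟩
  · exact integrableOn_const hK.measure_lt_top.ne
  · filter_upwards [hmem] with y hy s hs
    exact (hasDerivAt_slice hI hk (hball hs) (hKT hy)).const_mul _

/-! ### The variation of the volume -/

section VolumeVariation

variable {n : ℕ} [NeZero n]
  {M : Type*} [TopologicalSpace M] [ChartedSpace (EuclideanHalfSpace n) M]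
  {p : M → Minkowski n} {ε : ℝ} {F : ℝ → M → Minkowski n}

lemma IsVariation.contMDiff (hF : IsVariation p ε F) {t : ℝ} (ht : t ∈ Ioo (-ε) ε) :
    ContMDiff (𝓡∂ n) 𝓘(ℝ, Minkowski n) ∞ (F t) := by
  have h : ContMDiff (𝓡∂ n) (𝓘(ℝ, ℝ).prod (𝓡∂ n)) ∞ fun x : M ↦ (t, x) :=
    contMDiff_const.prodMk contMDiff_id
  exact contMDiffOn_univ.1 (hF.smooth.comp h.contMDiffOn fun x _ ↦ ⟨ht, mem_univ _⟩)

/-- The variation in the chart centred at `c`. -/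
noncomputable def chartFamily (F : ℝ → M → Minkowski n) (c : M) (z : ℝ × EuclideanSpace ℝ (Fin n)) :
    Minkowski n := F z.1 ((extChartAt (𝓡∂ n) c).symm z.2)

/-- The volume density of the variation in the chart centred at `c`. -/
noncomputable def chartDensity (ε : ℝ) (F : ℝ → M → Minkowski n) (c : M)
    (z : ℝ × EuclideanSpace ℝ (Fin n)) : ℝ :=
  √(familyGram (Ioo (-ε) ε ×ˢ (extChartAt (𝓡∂ n) c).target) (chartFamily F c) z).det

variable [IsManifold (𝓡∂ n) ∞ M]

lemma IsVariation.contDiffOn_chartFamily (hF : IsVariation p ε F) (c : M) :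
    ContDiffOn ℝ ∞ (chartFamily F c) (Ioo (-ε) ε ×ˢ (extChartAt (𝓡∂ n) c).target) := by
  have h : ContMDiffOn 𝓘(ℝ, ℝ × EuclideanSpace ℝ (Fin n)) (𝓘(ℝ, ℝ).prod (𝓡∂ n)) ∞
      (fun z : ℝ × EuclideanSpace ℝ (Fin n) ↦ (z.1, (extChartAt (𝓡∂ n) c).symm z.2))
      (Ioo (-ε) ε ×ˢ (extChartAt (𝓡∂ n) c).target) :=
    contDiff_fst.contMDiff.contMDiffOn.prodMk
      ((contMDiffOn_extChartAt_symm c).comp contDiff_snd.contMDiff.contMDiffOn fun z hz ↦ hz.2)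
  exact contMDiffOn_iff_contDiffOn.1 (hF.smooth.comp h fun z hz ↦ ⟨hz.1, mem_univ _⟩)

lemma IsVariation.coordMatrix_eq (hF : IsVariation p ε F) {t : ℝ} (ht : t ∈ Ioo (-ε) ε) {c : M}
    {y : EuclideanSpace ℝ (Fin n)} (hy : y ∈ (extChartAt (𝓡∂ n) c).target) :
    coordMatrix (inducedForm (F t)) c y =
      familyGram (Ioo (-ε) ε ×ˢ (extChartAt (𝓡∂ n) c).target) (chartFamily F c) (t, y) := by
  rw [coordMatrix_inducedForm (hF.contMDiff ht) hy,
    familyGram_eq (isRegularDomain_target c) (hF.contDiffOn_chartFamily c) ht hy]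
  rfl

lemma IsVariation.det_familyGram_pos (hF : IsVariation p ε F) (c : M) :
    ∀ z ∈ Ioo (-ε) ε ×ˢ (extChartAt (𝓡∂ n) c).target, 0 < (familyGram
      (Ioo (-ε) ε ×ˢ (extChartAt (𝓡∂ n) c).target) (chartFamily F c) z).det := by
  rintro ⟨t, y⟩ ⟨ht, hy⟩
  rw [← hF.coordMatrix_eq ht hy, coordMatrix_inducedForm (hF.contMDiff ht) hy]
  exact (posDef_gram fun v hv ↦
    minkowski_pd_pos (hF.contMDiff ht) (hF.spacelike t ht) hy hv).det_pos

lemma IsVariation.contDiffOn_chartDensity (hF : IsVariation p ε F) (c : M) :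
    ContDiffOn ℝ ∞ (chartDensity ε F c) (Ioo (-ε) ε ×ˢ (extChartAt (𝓡∂ n) c).target) :=
  (contDiffOn_det (contDiffOn_familyGram ((isRegularDomain_target c).prod isOpen_Ioo)
    (hF.contDiffOn_chartFamily c))).sqrt fun z hz ↦ (hF.det_familyGram_pos c z hz).ne'

lemma IsVariation.continuousOn_det (hF : IsVariation p ε F) {t : ℝ} (ht : t ∈ Ioo (-ε) ε) (c : M) :
    ContinuousOn (fun y ↦ (coordMatrix (inducedForm (F t)) c y).det)
      (extChartAt (𝓡∂ n) c).target := by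
  have h := (contDiffOn_det (contDiffOn_familyGram ((isRegularDomain_target c).prod isOpen_Ioo)
    (hF.contDiffOn_chartFamily c))).continuousOn
  refine (h.comp (f := fun y ↦ (t, y)) (by fun_prop) fun y hy ↦ ⟨ht, hy⟩).congr fun y hy ↦ ?_
  rw [hF.coordMatrix_eq ht hy]
  rfl

/-- The derivative along the parameter of the variation, in a chart. -/
noncomputable def timeDeriv (ε : ℝ) (c : M) (k : ℝ × EuclideanSpace ℝ (Fin n) → ℝ) :
    ℝ × EuclideanSpace ℝ (Fin n) → ℝ :=
  pd (Ioo (-ε) ε ×ˢ (extChartAt (𝓡∂ n) c).target) ((1 : ℝ), (0 : EuclideanSpace ℝ (Fin n))) k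

/-- The second variation of the volume density in a chart. -/
lemma IsCharacteristicVariation.timeDeriv_timeDeriv_chartDensity (hn : 2 ≤ n) (hε : 0 < ε)
    (hF : IsCharacteristicVariation p ε F) (hp : IsSpacelikeImmersion p)
    (hS : ∀ x : M, scalarCurvature (inducedForm p) x = 0) {c : M}
    {y : EuclideanSpace ℝ (Fin n)} (hy : y ∈ (extChartAt (𝓡∂ n) c).target) :
    timeDeriv ε c (timeDeriv ε c (chartDensity ε F c)) (0, y) =
      -secondVariationDensity p F ((extChartAt (𝓡∂ n) c).symm y) * chartDensity ε F c (0, y) := by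
  set T := (extChartAt (𝓡∂ n) c).target with hTdef
  have h0 : (0 : ℝ) ∈ Ioo (-ε) ε := ⟨by linarith, hε⟩
  have hV := hF.toIsAdmissibleVariation.toIsVariation
  obtain ⟨φ, hφ⟩ := hF.admissible
  obtain ⟨ψ, hψ⟩ := hF.characteristic
  have hT : IsRegularDomain T := isRegularDomain_target c
  have hf := hV.contDiffOn_chartFamily c
  have hD := hV.contDiffOn_chartDensity c
  have hF0 : F 0 = p := funext hV.initial
  have htr := hp.trace_shapeMatrix hy rfl rfl
  have hq := hp.isNullFrame_dualMap hy
  have h1 := hasDerivAt_deriv_density (p := p ∘ (extChartAt (𝓡∂ n) c).symm)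
    (q := dualMap p ∘ (extChartAt (𝓡∂ n) c).symm) (φ := φ ∘ (extChartAt (𝓡∂ n) c).symm)
    (ψ := ψ ∘ (extChartAt (𝓡∂ n) c).symm) isOpen_Ioo h0 hT hf
    (fun y _ ↦ hV.initial _) (hV.det_familyGram_pos c) (fun y hy ↦ hp.isNullFrame_dualMap hy)
    (fun y _ ↦ hφ ((extChartAt (𝓡∂ n) c).symm y)) (fun y _ ↦ hψ ((extChartAt (𝓡∂ n) c).symm y)) hy
    (htr.1.trans (hp.trace_shapeOperator_eq_zero hn (hS _)))
  have h2 : HasDerivAt (deriv fun t ↦ chartDensity ε F c (t, y))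
      (timeDeriv ε c (timeDeriv ε c (chartDensity ε F c)) (0, y)) 0 := by
    refine (hasDerivAt_slice isOpen_Ioo (contDiffOn_pd (hT.prod isOpen_Ioo) hD _) h0
      hy).congr_of_eventuallyEq ?_
    filter_upwards [isOpen_Ioo.mem_nhds h0] with t ht
    exact (hasDerivAt_slice isOpen_Ioo hD ht hy).deriv
  have hX : minkowski (variationField F ((extChartAt (𝓡∂ n) c).symm y))
      (p ((extChartAt (𝓡∂ n) c).symm y)) = φ ((extChartAt (𝓡∂ n) c).symm y) := by
    rw [hφ, minkowski_smul_left, minkowski_comm, hq.pq, mul_one]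
  have hG : chartDensity ε F c (0, y) =
      √(gram T (p ∘ (extChartAt (𝓡∂ n) c).symm) y).det := by
    rw [chartDensity, ← hV.coordMatrix_eq h0 hy, hF0, coordMatrix_inducedForm hp.smooth hy]
  rw [h2.unique h1, hG, secondVariationDensity, hX, ← htr.2]
  rfl

/-- The integrand of the second variation formula is continuous. -/
lemma IsCharacteristicVariation.continuous_secondVariationDensity (hn : 2 ≤ n) (hε : 0 < ε)
    (hF : IsCharacteristicVariation p ε F) (hp : IsSpacelikeImmersion p)
    (hS : ∀ x : M, scalarCurvature (inducedForm p) x = 0) :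
    Continuous (secondVariationDensity p F) := by
  have h0 : (0 : ℝ) ∈ Ioo (-ε) ε := ⟨by linarith, hε⟩
  have hV := hF.toIsAdmissibleVariation.toIsVariation
  rw [continuous_iff_continuousAt]
  intro c
  have hT := isRegularDomain_target (n := n) c
  have hD := hV.contDiffOn_chartDensity c
  have hD2 := contDiffOn_pd (hT.prod isOpen_Ioo) (contDiffOn_pd (hT.prod isOpen_Ioo) hD
    ((1 : ℝ), (0 : EuclideanSpace ℝ (Fin n)))) ((1 : ℝ), (0 : EuclideanSpace ℝ (Fin n)))
  have hpos : ∀ z ∈ Ioo (-ε) ε ×ˢ (extChartAt (𝓡∂ n) c).target, chartDensity ε F c z ≠ 0 :=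
    fun z hz ↦ (Real.sqrt_pos.2 (hV.det_familyGram_pos c z hz)).ne'
  have hm : MapsTo (fun x ↦ ((0 : ℝ), extChartAt (𝓡∂ n) c x)) (extChartAt (𝓡∂ n) c).source
      (Ioo (-ε) ε ×ˢ (extChartAt (𝓡∂ n) c).target) :=
    fun x hx ↦ ⟨h0, (extChartAt (𝓡∂ n) c).map_source hx⟩
  have h1 := (hD2.continuousOn.div hD.continuousOn hpos).comp
    (continuousOn_const.prodMk (continuousOn_extChartAt c)) hm
  refine (h1.neg.congr fun x hx ↦ ?_).continuousAt (extChartAt_source_mem_nhds c)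
  have h2 := hF.timeDeriv_timeDeriv_chartDensity hn hε hp hS
    ((extChartAt (𝓡∂ n) c).map_source hx)
  rw [(extChartAt (𝓡∂ n) c).left_inv hx, timeDeriv, timeDeriv] at h2
  have h3 := hpos _ (hm hx)
  change _ = -(pd _ _ (pd _ _ _) ((0 : ℝ), extChartAt (𝓡∂ n) c x) /
    chartDensity ε F c ((0 : ℝ), extChartAt (𝓡∂ n) c x))
  rw [h2, mul_div_cancel_right₀ _ h3, neg_neg]

/-- The trace of `A²` is nonnegative because `A` is symmetric. -/
lemma IsSpacelikeImmersion.secondVariationDensity_nonneg (hp : IsSpacelikeImmersion p) (x : M) :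
    0 ≤ secondVariationDensity p F x := by
  have hy := mem_extChartAt_target (I := 𝓡∂ n) x
  refine mul_nonneg (sq_nonneg _) ?_
  have h := (hp.trace_shapeMatrix hy rfl rfl).2
  rw [extChartAt_to_inv] at h
  rw [← h]
  refine trace_sq_nonneg (posDef_gram fun v hv ↦ minkowski_pd_pos hp.smooth hp.pos hy hv) ?_
  ext i j
  exact shapeMatrix_symm (isRegularDomain_target x) (contDiffOn_comp_extChartAt_symm hp.smooth x)
    hy j i

variable [CompactSpace M] [T2Space M] [MeasurableSpace M] [BorelSpace M]

lemma IsVariation.variationVolume_eq (hF : IsVariation p ε F) {t : ℝ} (ht : t ∈ Ioo (-ε) ε) :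
    variationVolume F t = ∑ c ∈ activeCharts n M, ∫ y in chartCompact c, chartWeight c y *
      chartDensity ε F c (t, y) := by
  rw [variationVolume, (volumeMeasure_univ (hF.continuousOn_det ht)).2]
  refine Finset.sum_congr rfl fun c _ ↦ setIntegral_congr_fun
    (isCompact_chartCompact c).measurableSet fun y hy ↦ ?_
  simp only [chartDensity, hF.coordMatrix_eq ht (chartCompact_subset_target c hy)]

lemma IsVariation.hasDerivAt_variationVolume (hF : IsVariation p ε F) {t : ℝ}
    (ht : t ∈ Ioo (-ε) ε) :
    HasDerivAt (variationVolume F) (∑ c ∈ activeCharts n M, ∫ y in chartCompact c,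
      chartWeight c y * timeDeriv ε c (chartDensity ε F c) (t, y)) t := by
  have h := HasDerivAt.fun_sum (u := activeCharts n M) fun c _ ↦ hasDerivAt_integral_slice
    isOpen_Ioo (isRegularDomain_target c) (isCompact_chartCompact c)
    (chartCompact_subset_target c)
    ((continuousOn_chartWeight c).mono (chartCompact_subset_target c))
    (hF.contDiffOn_chartDensity c) ht
  refine h.congr_of_eventuallyEq ?_
  filter_upwards [isOpen_Ioo.mem_nhds ht] with s hs
  exact hF.variationVolume_eq hs

lemma IsVariation.hasDerivAt_deriv_variationVolume (hF : IsVariation p ε F) {t : ℝ}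
    (ht : t ∈ Ioo (-ε) ε) :
    HasDerivAt (deriv (variationVolume F)) (∑ c ∈ activeCharts n M, ∫ y in chartCompact c,
      chartWeight c y * timeDeriv ε c (timeDeriv ε c (chartDensity ε F c)) (t, y)) t := by
  have h := HasDerivAt.fun_sum (u := activeCharts n M) fun c _ ↦ hasDerivAt_integral_slice
    isOpen_Ioo (isRegularDomain_target c) (isCompact_chartCompact c)
    (chartCompact_subset_target c)
    ((continuousOn_chartWeight c).mono (chartCompact_subset_target c))
    (contDiffOn_pd ((isRegularDomain_target c).prod isOpen_Ioo) (hF.contDiffOn_chartDensity c)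
      ((1 : ℝ), (0 : EuclideanSpace ℝ (Fin n)))) ht
  refine h.congr_of_eventuallyEq ?_
  filter_upwards [isOpen_Ioo.mem_nhds ht] with s hs
  exact (hF.hasDerivAt_variationVolume hs).deriv

end VolumeVariation

end LightCone

theorem mainTheorem3 {n : ℕ} [NeZero n] (hn : 2 ≤ n)
    {M : Type*} [TopologicalSpace M] [ChartedSpace (EuclideanHalfSpace n) M]
    [IsManifold (𝓡∂ n) ∞ M] [CompactSpace M] [T2Space M] [MeasurableSpace M] [BorelSpace M]
    (g : Bundle.ContMDiffRiemannianMetric (𝓡∂ n) ∞ (EuclideanSpace ℝ (Fin n))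
      (fun x : M ↦ TangentSpace (𝓡∂ n) x))
    (hflat : LightCone.IsConformallyFlat (LightCone.metricForm g))
    (p : M → LightCone.Minkowski n)
    (hp : LightCone.IsIsometricImmersion (LightCone.metricForm g) p)
    (hS : ∀ x : M, LightCone.scalarCurvature (LightCone.metricForm g) x = 0)
    (ε : ℝ) (hε : 0 < ε) (F : ℝ → M → LightCone.Minkowski n)
    (hF : LightCone.IsCharacteristicVariation p ε F) :
    -- the volumes and the integral exist, and the volume is differentiable
    (∀ t ∈ Set.Ioo (-ε) ε,
      LightCone.volumeMeasure (LightCone.inducedForm (F t)) Set.univ < ⊤ ∧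
      DifferentiableAt ℝ (LightCone.variationVolume F) t) ∧
    MeasureTheory.Integrable (LightCone.secondVariationDensity p F)
      (LightCone.volumeMeasure (LightCone.metricForm g)) ∧
    -- the second variation formula
    HasDerivAt (deriv (LightCone.variationVolume F))
      (-∫ x, LightCone.secondVariationDensity p F x
        ∂(LightCone.volumeMeasure (LightCone.metricForm g))) 0 ∧
    -- its sign
    -∫ x, LightCone.secondVariationDensity p F x
      ∂(LightCone.volumeMeasure (LightCone.metricForm g)) ≤ 0 := by
  have h0 : (0 : ℝ) ∈ Ioo (-ε) ε := ⟨by linarith, hε⟩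
  have hV := hF.toIsAdmissibleVariation.toIsVariation
  have hF0 : F 0 = p := funext hV.initial
  have hg : LightCone.metricForm g = LightCone.inducedForm p := by
    funext x v w
    exact (hp.isometric x v w).symm
  have hps : LightCone.IsSpacelikeImmersion p :=
    ⟨hp.smooth, hp.mem_lightCone, hF0 ▸ hV.spacelike 0 h0⟩
  rw [hg] at hS ⊢
  have hcont := hF.continuous_secondVariationDensity hn hε hps hS
  have hdet := hF0 ▸ hV.continuousOn_det h0
  have hint := LightCone.integral_volumeMeasure hdet hcont
  have hneg : -∫ x, LightCone.secondVariationDensity p F x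
      ∂(LightCone.volumeMeasure (LightCone.inducedForm p)) ≤ 0 :=
    neg_nonpos.2 (integral_nonneg fun x ↦ hps.secondVariationDensity_nonneg x)
  refine ⟨fun t ht ↦ ⟨(LightCone.volumeMeasure_univ (hV.continuousOn_det ht)).1,
    (hV.hasDerivAt_variationVolume ht).differentiableAt⟩, hint.1, ?_, hneg⟩
  refine (hV.hasDerivAt_deriv_variationVolume h0).congr_deriv ?_
  rw [hint.2, ← Finset.sum_neg_distrib]
  refine Finset.sum_congr rfl fun c _ ↦ ?_
  rw [← integral_neg]
  refine setIntegral_congr_fun (LightCone.isCompact_chartCompact c).measurableSet fun y hy ↦ ?_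
  have hyT := LightCone.chartCompact_subset_target c hy
  have hG := hV.coordMatrix_eq h0 hyT
  rw [hF0] at hG
  simp only [hF.timeDeriv_timeDeriv_chartDensity hn hε hps hS hyT, LightCone.chartDensity, hG]
  ring
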